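/- Let $(\mathcal A,D,\mathcal H)$ be a spectral triple: $\mathcal A$ is a complex algebra acting on the Hilbert space $\mathcal H$, and $D$ is a self-adjoint operator on $\mathcal H$ with compact resolvent such that $[D,a]$ is bounded for every $a\in\mathcal A$; assume moreover that $0$ is not an eigenvalue of $D$, so that $D^{-1}$ is compact. For a compact operator $T$ let $\mu_1(T)\ge\mu_2(T)\ge\dots$ be the eigenvalues of $|T|$ in non-increasing order, counted with multiplicity (followed by zeros if there are only finitely many non-zero ones). When all $\mu_n(T)$ are positive, put $f_T(t)=-\log\mu_{\lfloor e^t\rfloor}(T)$ for $t\ge 0$, and $$\underline c(T)=\Bigl(\lim_{h\to\infty}\limsup_{t\to\infty}\frac{f_T(t+h)-f_T(t)}{h}\Bigr)^{-1},\qquad \overline c(T)=\Bigl(\lim_{h\to\infty}\liminf_{t\to\infty}\frac{f_T(t+h)-f_T(t)}{h}\Bigr)^{-1}$$ in $[0,\infty]$. Let $\mathcal L^{1,\infty}$ (resp. $\mathcal L^{1,\infty}_0$) be the set of compact $T$ with $\sum_{k=1}^n\mu_k(T)=O(\log n)$ (resp. $o(\log n)$). A singular trace on $\mathcal B(\mathcal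 H)$ is an additive, positively homogeneous map $\tau:\mathcal B(\mathcal H)_+\to[0,\infty]$ with $\tau(A^*A)=\tau(AA^*)$ for all $A$ that vanishes on all finite rank projections. A number $\alpha\in(0,\infty)$ is an exponent of singular traceability of a compact operator $T$ if $\tau(|T|^\alpha)=1$ for some singular trace $\tau$. (i) If $\underline c(|D|^{-1})=\overline c(|D|^{-1})=c\in(0,\infty)$, then the dimension of the spectral triple is $c$, that is, $$\inf\{d>0:|D|^{-d}\in\mathcal L^{1,\infty}_0\}=\sup\{d>0:|D|^{-d}\notin\mathcal L^{1,\infty}\}=c,$$ and $c$ is the unique exponent of singular traceability of $D^{-1}$. (ii) If $\lim_{n\to\infty}\mu_n(D^{-1})/\mu_{2n}(D^{-1})$ exists and lies in $(1,\infty)$, then $\underline c(|D|^{-1})=\overline c(|D|^{-1})\in(0,\infty)$, so that the conclusion of (i) holds. -/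

import Mathlib

open Filter Topology
open scoped ENNReal NNReal

/-! ### Singular values of bounded operators -/

section Operators

variable {H : Type*} [NormedAddCommGroup H] [InnerProductSpace ℂ H] [CompleteSpace H]

/-- The number (a cardinal) of eigenvalues of `T` that are real and larger than `t`, counted with
multiplicity: the dimension of the span of the corresponding eigenspaces. -/
noncomputable def eigenvalueCount (T : H →L[ℂ] H) (t : ℝ) : Cardinal :=
  Module.rank ℂ
    ↥(⨆ s ∈ Set.Ioi t, Module.End.eigenspace (T : H →ₗ[ℂ] H) (s : ℂ))

/-- For a compact operator `T` and `n ≥ 1`, the `n`-th eigenvalue `μ_n(T)` of `|T|`, the eigenvalues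
of `|T|` being arranged in non-increasing order and counted with multiplicity (and followed by zeros
if there are only finitely many non-zero ones): the smallest `t ≥ 0` such that fewer than `n`
eigenvalues of `|T|` exceed `t`. The index starts at `1`; the value at `n = 0` is not used. -/
noncomputable def singularValue (T : H →L[ℂ] H) (n : ℕ) : ℝ :=
  sInf {t : ℝ | 0 ≤ t ∧ eigenvalueCount (CFC.abs T) t < (n : Cardinal)}

/-- `T` belongs to `𝓛^{1,∞}`: it is compact and `∑_{k=1}^n μ_k(T) = O(log n)`. -/
def MemL1Infty (T : H →L[ℂ] H) : Prop :=
  IsCompactOperator T ∧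
    (fun n : ℕ => ∑ k ∈ Finset.Icc 1 n, singularValue T k) =O[atTop]
      (fun n : ℕ => Real.log (n : ℝ))

/-- `T` belongs to `𝓛_0^{1,∞}`: it is compact and `∑_{k=1}^n μ_k(T) = o(log n)`. -/
def MemL1InftyZero (T : H →L[ℂ] H) : Prop :=
  IsCompactOperator T ∧
    (fun n : ℕ => ∑ k ∈ Finset.Icc 1 n, singularValue T k) =o[atTop]
      (fun n : ℕ => Real.log (n : ℝ))

/-! ### The two numbers bounding singular traceability -/

/-- The function `f(t) = -log μ(e^t)`, where `μ(x) = μ_n(T)` for `x ∈ [n, n + 1)`. It is real valued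
and non-decreasing for `t ≥ 0` when no singular value of `T` vanishes. -/
noncomputable def logSingularValue (T : H →L[ℂ] H) (t : ℝ) : ℝ :=
  -Real.log (singularValue T ⌊Real.exp t⌋₊)

/-- `c` is the number `(lim_{h → ∞} limsup_{t → ∞} (f(t + h) - f(t)) / h)⁻¹` of `[0, ∞]`
(with `0⁻¹ = ∞` and `∞⁻¹ = 0`), the limit being required to exist. -/
def IsLowerC (T : H →L[ℂ] H) (c : ℝ≥0∞) : Prop :=
  Tendsto
    (fun h : ℝ => limsup (fun t : ℝ =>
      ENNReal.ofReal ((logSingularValue T (t + h) - logSingularValue T t) / h)) atTop)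
    atTop (𝓝 c⁻¹)

/-- `c` is the number `(lim_{h → ∞} liminf_{t → ∞} (f(t + h) - f(t)) / h)⁻¹` of `[0, ∞]`
(with `0⁻¹ = ∞` and `∞⁻¹ = 0`), the limit being required to exist. -/
def IsUpperC (T : H →L[ℂ] H) (c : ℝ≥0∞) : Prop :=
  Tendsto
    (fun h : ℝ => liminf (fun t : ℝ =>
      ENNReal.ofReal ((logSingularValue T (t + h) - logSingularValue T t) / h)) atTop)
    atTop (𝓝 c⁻¹)

end Operators

/-! ### Singular traces -/

/-- A singular trace on `B(H)`: a tracial weight, i.e. an additive, positively homogeneous map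
`τ` from the positive operators to `[0, ∞]` with `τ(A* A) = τ(A A*)`, that vanishes on the finite
rank projections. The values of `toFun` outside the positive cone are irrelevant. -/
structure SingularTrace (H : Type*) [NormedAddCommGroup H] [InnerProductSpace ℂ H]
    [CompleteSpace H] where
  toFun : (H →L[ℂ] H) → ℝ≥0∞
  map_add : ∀ A B : H →L[ℂ] H, 0 ≤ A → 0 ≤ B → toFun (A + B) = toFun A + toFun B
  map_smul : ∀ (r : ℝ≥0) (A : H →L[ℂ] H), 0 ≤ A →
    toFun (((r : ℝ) : ℂ) • A) = (r : ℝ≥0∞) * toFun A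
  tracial : ∀ A : H →L[ℂ] H, toFun (star A * A) = toFun (A * star A)
  map_projection : ∀ P : H →L[ℂ] H, IsStarProjection P →
    FiniteDimensional ℂ ↥(LinearMap.range (P : H →ₗ[ℂ] H)) → toFun P = 0

/-- `α ∈ (0, ∞)` is an exponent of singular traceability for `T`: some singular trace takes the
value `1` on `|T|^α`. -/
def IsExponentOfSingularTraceability {H : Type*} [NormedAddCommGroup H] [InnerProductSpace ℂ H]
    [CompleteSpace H] (T : H →L[ℂ] H) (α : ℝ) : Prop :=
  0 < α ∧ ∃ τ : SingularTrace H, τ.toFun (CFC.abs T ^ α) = 1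

/-! ### Spectral triples -/

/-- `R` is the bounded, everywhere defined inverse `(D - z)⁻¹` of the unbounded operator `D - z`. -/
def IsResolventAt {H : Type*} [NormedAddCommGroup H] [InnerProductSpace ℂ H]
    (D : H →ₗ.[ℂ] H) (z : ℂ) (R : H →L[ℂ] H) : Prop :=
  (∀ y : H, ∃ hy : R y ∈ D.domain, D ⟨R y, hy⟩ - z • R y = y) ∧
    ∀ x : D.domain, R (D x - z • (x : H)) = x

/-- A spectral triple `(𝓐, D, H)`: a complex algebra `𝓐` acting on the Hilbert space `H` and a
(densely defined, in general unbounded) self-adjoint operator `D` on `H` with compact resolvent such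
that `[D, a]` is bounded for every `a` in `𝓐`. As a standing convention, `0` is not an eigenvalue
of `D`. -/
structure SpectralTriple (𝓐 : Type*) (H : Type*) [NonUnitalRing 𝓐] [Module ℂ 𝓐]
    [IsScalarTower ℂ 𝓐 𝓐] [SMulCommClass ℂ 𝓐 𝓐]
    [NormedAddCommGroup H] [InnerProductSpace ℂ H] [CompleteSpace H] where
  /-- the action of the algebra -/
  rep : 𝓐 →ₙₐ[ℂ] (H →L[ℂ] H)
  /-- the Dirac operator -/
  D : H →ₗ.[ℂ] H
  dense_domain : Dense (D.domain : Set H)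
  selfAdjoint : IsSelfAdjoint D
  /-- every `a` preserves the domain of `D`, and `D a - a D` is bounded on this domain -/
  bounded_commutator : ∀ a : 𝓐, ∃ h : ∀ x : D.domain, rep a x ∈ D.domain,
    ∃ C : ℝ, ∀ x : D.domain, ‖D ⟨rep a x, h x⟩ - rep a (D x)‖ ≤ C * ‖(x : H)‖
  compact_resolvent : ∃ (z : ℂ) (R : H →L[ℂ] H), IsResolventAt D z R ∧ IsCompactOperator R
  ker_eq_zero : ∀ x : D.domain, D x = 0 → (x : H) = 0

namespace SpectralTriple

variable {𝓐 H : Type*} [NonUnitalRing 𝓐] [Module ℂ 𝓐]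
    [IsScalarTower ℂ 𝓐 𝓐] [SMulCommClass ℂ 𝓐 𝓐]
  [NormedAddCommGroup H] [InnerProductSpace ℂ H] [CompleteSpace H]

/-- The operator `D` has a bounded, everywhere defined, compact inverse. -/
theorem exists_inverse (S : SpectralTriple 𝓐 H) :
    ∃ R : H →L[ℂ] H, IsResolventAt S.D 0 R ∧ IsCompactOperator R := by
  obtain ⟨z, R, ⟨hR1, hR2⟩, hc⟩ := S.compact_resolvent
  by_cases hz : z = 0
  · subst hz
    exact ⟨R, ⟨hR1, hR2⟩, hc⟩
  have hDR : ∀ y, ∃ hy : R y ∈ S.D.domain, S.D ⟨R y, hy⟩ = y + z • R y := by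
    intro y
    obtain ⟨hy, e⟩ := hR1 y
    exact ⟨hy, sub_eq_iff_eq_add.mp e⟩
  have hinj : ∀ x y : S.D.domain, S.D x = S.D y → (x : H) = y := by
    intro x y h
    have := S.ker_eq_zero (x - y) (by rw [LinearPMap.map_sub, h, sub_self])
    simpa [sub_eq_zero] using this
  have hz' : -z⁻¹ ≠ 0 := neg_ne_zero.mpr (inv_ne_zero hz)
  rcases hc.hasEigenvalue_or_mem_resolventSet hz' with h | h
  · exfalso
    obtain ⟨x, hx⟩ := h.exists_hasEigenvector
    have e : R x = (-z⁻¹) • x := hx.apply_eq_smul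
    obtain ⟨hy, e2⟩ := hDR x
    have e3 : S.D ⟨R x, hy⟩ = 0 := by
      rw [e2, e, smul_smul]
      simp [hz]
    have e4 : R x = 0 := S.ker_eq_zero _ e3
    rw [e] at e4
    exact hx.2 ((smul_eq_zero.mp e4).resolve_left hz')
  · rw [spectrum.mem_resolventSet_iff] at h
    obtain ⟨u, hu⟩ := h
    have huinv : ∀ y, (-z⁻¹) • ((↑u⁻¹ : H →L[ℂ] H) y) - R ((↑u⁻¹ : H →L[ℂ] H) y) = y := by
      intro y
      have h1 : (u : H →L[ℂ] H) ((↑u⁻¹ : H →L[ℂ] H) y) = y := by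
        exact congrArg (fun T : H →L[ℂ] H => T y) u.mul_inv
      rw [hu] at h1
      simpa [Algebra.algebraMap_eq_smul_one] using h1
    let V : H →L[ℂ] H := (-z⁻¹) • (↑u⁻¹ : H →L[ℂ] H)
    have hV : ∀ y, V y + z • R (V y) = y := by
      intro y
      have h2 := huinv y
      have h3 : z • R (V y) = - R ((↑u⁻¹ : H →L[ℂ] H) y) := by
        simp [V, smul_smul, hz]
      rw [h3]
      rw [← sub_eq_add_neg]
      exact h2
    have hA : ∀ y, ∃ hy : R (V y) ∈ S.D.domain, S.D ⟨R (V y), hy⟩ = y := by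
      intro y
      obtain ⟨hy, e⟩ := hDR (V y)
      exact ⟨hy, e.trans (hV y)⟩
    refine ⟨R.comp V, ⟨fun y => ?_, fun x => ?_⟩, hc.comp_clm V⟩
    · obtain ⟨hy, e⟩ := hA y
      exact ⟨hy, by simpa using e⟩
    · obtain ⟨hy, e⟩ := hA (S.D x)
      simpa using hinj _ _ e

/-- The (compact) inverse `D⁻¹` of the Dirac operator. -/
noncomputable def Dinv (S : SpectralTriple 𝓐 H) : H →L[ℂ] H :=
  S.exists_inverse.choose

/-- The operator `|D|⁻¹ = |D⁻¹|`. -/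
noncomputable def absDinv (S : SpectralTriple 𝓐 H) : H →L[ℂ] H :=
  CFC.abs S.Dinv

/-- The dimension `d(𝓐, D, H) = inf {d > 0 : |D|^{-d} ∈ 𝓛_0^{1,∞}}`, an element of `[0, ∞]`. -/
noncomputable def dimension (S : SpectralTriple 𝓐 H) : ℝ≥0∞ :=
  sInf (ENNReal.ofReal '' {d : ℝ | 0 < d ∧ MemL1InftyZero (S.absDinv ^ d)})

/-- The other expression `sup {d > 0 : |D|^{-d} ∉ 𝓛^{1,∞}}` for the dimension. -/
noncomputable def dimensionSup (S : SpectralTriple 𝓐 H) : ℝ≥0∞ :=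
  sSup (ENNReal.ofReal '' {d : ℝ | 0 < d ∧ ¬ MemL1Infty (S.absDinv ^ d)})

end SpectralTriple

/-! Since `D⁻¹` is compact and injective, `|D|⁻¹` is diagonal in a Hilbert basis, with positive
eigenvalues decreasing to `0` (`exists_diagonalization`), so the question is about one sequence.
Equality of the two slope numbers says that this sequence has `RegularDecay` of exponent `1/c`:
passing from index `n` to `N n` multiplies it by `N ^ (-1/c)`, up to `N ^ (±ε)`. Taking the power
`d` turns the exponent into `d/c`.

Let `b` be the eigenvalue sequence of `|D|^{-d}`. If `d ≠ c`, then `b k` compares with `r * b (k /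
M)`, where `r * M < 1` for `d > c` and `r * M > 1` for `d < c` (`exists_contraction`,
`exists_expansion`). This decides both questions. The partial sums of `b` are bounded in the first
case and grow faster than the logarithm in the second, which gives the dimension. The operator with
eigenvalues `b (k / M)` is a sum of `M` isometric conjugates of the original one, so a singular
trace takes `M` times the value on it (`exists_dilation`); the value `1` is therefore excluded.

For `d = c` a trace has to be built. Let `σ m A` be the Ky Fan sum, the supremum of partial traces
of `A` over orthonormal families of at most `m` vectors. On the class of operators dominated by `b`,
`σ m` is additive up to `O(m * b m)`, because `σ m A + σ m B ≤ σ (2 m) (A + B) ≤ σ m (A + B) + O(m *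
b m)`. Dividing by `σ m T` and taking an ultrafilter limit along indices where `m * b m = o(σ m T)`
gives a singular trace equal to `1` at `T`. If `σ m T` is bounded, the tails `sup σ - σ m` replace
the sums. Such indices exist because otherwise `σ` (or the tail) would change by a fixed factor at
each doubling, which contradicts decay of exponent `1` (`frequently_le_of_increments`,
`frequently_le_of_decrements`).

For (ii), each doubling of the index raises `f` by about `log L`, so the slope over a length `x` is
`log L / log 2 + O(1/x)`. -/

/-! ### Operators diagonal in a Hilbert basis. -/

section Diagonal

variable {ι H : Type*} [NormedAddCommGroup H] [InnerProductSpace ℂ H]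

theorem HilbertBasis.eq_zero_of_inner_eq_zero (e : HilbertBasis ι ℂ H) {x : H}
    (h : ∀ i, inner ℂ (e i) x = 0) : x = 0 := by
  apply e.repr.injective
  ext i
  simp [e.repr_apply_apply, h]

variable {e : HilbertBasis ι ℂ H} {T : H →L[ℂ] H} {a : ι → ℝ}

theorem inner_apply_of_diagonal (hT : ∀ i, T (e i) = (a i : ℂ) • e i) (x : H) (i : ι) :
    inner ℂ (e i) (T x) = a i * inner ℂ (e i) x := by
  classical
  have h1 : HasSum (fun j => T (e.repr x j • e j)) (T x) := (e.hasSum_repr x).mapL T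
  have h2 := h1.mapL (innerSL ℂ (e i))
  have h3 := hasSum_single (f := fun j => innerSL ℂ (e i) (T (e.repr x j • e j))) i (by
    intro j hj
    simp [hT, orthonormal_iff_ite.mp e.orthonormal, hj.symm])
  have h4 := h2.unique h3
  rw [innerSL_apply_apply] at h4
  rw [h4]
  simp [hT, e.repr_apply_apply, e.orthonormal.1, -Complex.coe_smul, mul_comm]

theorem hasSum_re_inner_of_diagonal (hT : ∀ i, T (e i) = (a i : ℂ) • e i) (x : H) :
    HasSum (fun i => a i * ‖inner ℂ (e i) x‖ ^ 2) (inner ℂ x (T x)).re := by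
  have h := Complex.hasSum_re (e.hasSum_inner_mul_inner x (T x))
  refine h.congr_fun ?_ |> fun h => h
  intro i
  rw [inner_apply_of_diagonal hT, ← inner_conj_symm x (e i)]
  rw [mul_left_comm, RCLike.conj_mul]
  simp [← Complex.ofReal_pow]

theorem nonneg_of_diagonal [CompleteSpace H] (hT : ∀ i, T (e i) = (a i : ℂ) • e i)
    (ha : ∀ i, 0 ≤ a i) : 0 ≤ T := by
  rw [ContinuousLinearMap.nonneg_iff_isPositive, ContinuousLinearMap.isPositive_iff_complex]
  intro x
  have h := hasSum_re_inner_of_diagonal hT x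
  have him : (inner ℂ (T x) x).im = 0 := by
    have h := Complex.hasSum_im (e.hasSum_inner_mul_inner (T x) x)
    refine h.unique ?_
    convert hasSum_zero with i
    rw [← inner_conj_symm, inner_apply_of_diagonal hT, map_mul, mul_assoc, RCLike.conj_mul]
    simp [← Complex.ofReal_pow]
  refine ⟨Complex.ext ?_ ?_, ?_⟩
  · simp
  · simpa using him.symm
  · rw [← inner_conj_symm, RCLike.conj_re]
    exact h.nonneg fun i => mul_nonneg (ha i) (by positivity)

end Diagonal

/-! ### Eigenvector bases of positive compact operators. -/

section Spectral

universe u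

variable {H : Type u} [NormedAddCommGroup H] [InnerProductSpace ℂ H] [CompleteSpace H]

theorem exists_hilbertBasis_eigenvectors {Q : H →L[ℂ] H} (hQ : IsCompactOperator Q) (h0 : 0 ≤ Q) :
    ∃ (ι : Type u) (e : HilbertBasis ι ℂ H) (q : ι → ℝ), ∀ i, Q (e i) = (q i : ℂ) • e i := by
  have hpos := (ContinuousLinearMap.nonneg_iff_isPositive Q).mp h0
  have hsym := hpos.isSymmetric
  have horth := hsym.orthogonalFamily_eigenspaces
  have hbot := ContinuousLinearMap.orthogonalComplement_iSup_eigenspaces_eq_bot hQ hsym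
  -- Closedness makes every eigenspace complete, also the possibly infinite-dimensional kernel, so
  -- each one has its own Hilbert basis; the union of these is the required basis.
  have hcl : ∀ μ : ℂ, IsClosed (Module.End.eigenspace (Q : H →ₗ[ℂ] H) μ : Set H) := by
    intro μ
    have : (Module.End.eigenspace (Q : H →ₗ[ℂ] H) μ : Set H) = {x | Q x = μ • x} := by
      ext x; simp
    rw [this]
    exact isClosed_eq Q.continuous (continuous_const_smul μ)
  have hc : ∀ μ : ℂ, CompleteSpace (Module.End.eigenspace (Q : H →ₗ[ℂ] H) μ) :=
    fun μ => (hcl μ).completeSpace_coe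
  choose w b hb using fun μ : ℂ =>
    exists_hilbertBasis ℂ (Module.End.eigenspace (Q : H →ₗ[ℂ] H) μ)
  have hon := horth.orthonormal_sigma_orthonormal (fun μ => (b μ).orthonormal)
  refine ⟨Σ μ : ℂ, w μ, HilbertBasis.mkOfOrthogonalEqBot hon ?_, fun i => i.1.re, ?_⟩
  · rw [eq_bot_iff, ← hbot]
    intro x hx
    rw [Submodule.mem_orthogonal] at hx
    rw [← Submodule.iInf_orthogonal, Submodule.mem_iInf]
    intro μ
    rw [Submodule.mem_orthogonal']
    intro u hu
    have hd := (b μ).hasSum_repr ⟨u, hu⟩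
    have h1 := (hd.mapL (Submodule.subtypeL _)).mapL (innerSL ℂ x)
    refine h1.unique ?_
    convert hasSum_zero with i
    have := hx _ (Submodule.subset_span ⟨⟨μ, i⟩, rfl⟩)
    rw [← inner_conj_symm] at this
    simp only [map_eq_zero] at this
    simp
    right
    simpa using this
  · rintro ⟨μ, i⟩
    rw [HilbertBasis.coe_mkOfOrthogonalEqBot]
    have hv : Q (b μ i : H) = μ • (b μ i : H) :=
      Module.End.mem_eigenspace_iff.mp (b μ i).2
    have hn : ‖(b μ i : H)‖ = 1 := (b μ).orthonormal.1 i
    have hre : (μ.re : ℂ) = μ := by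
      have h1 := hpos.inner_nonneg_right (b μ i : H)
      rw [hv, inner_smul_right, inner_self_eq_norm_sq_to_K, hn] at h1
      have h2 := (Complex.le_def.mp h1).2
      apply Complex.ext <;> simp at h2 ⊢
      exact h2
    simp only [Submodule.coe_subtypeₗᵢ, Submodule.coe_subtype, hre, hv]

-- Infinitely many orthonormal eigenvectors with eigenvalue at least `t` would have images pairwise
-- at distance at least `t √2`, so no subsequence of the images could converge.
omit [CompleteSpace H] in
theorem finite_setOf_le_eigenvalue {ι : Type*} {e : ι → H} (he : Orthonormal ℂ e) {Q : H →L[ℂ] H}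
    (hQ : IsCompactOperator Q) {q : ι → ℝ} (h : ∀ i, Q (e i) = (q i : ℂ) • e i) {t : ℝ}
    (ht : 0 < t) : {i | t ≤ q i}.Finite := by
  by_contra hinf
  have hinf : {i | t ≤ q i}.Infinite := hinf
  obtain ⟨f⟩ : Nonempty (ℕ ↪ {i | t ≤ q i}) := ⟨hinf.natEmbedding⟩
  obtain ⟨K, hK, hsub⟩ := hQ.image_closedBall_subset_compact (f := (Q : H →ₗ[ℂ] H)) 1
  obtain ⟨y, -, φ, hφ, hlim⟩ := hK.tendsto_subseq (x := fun n => Q (e (f n))) (fun n =>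
    hsub ⟨e (f n), by simp [he.1], rfl⟩)
  have hc := hlim.cauchySeq
  rw [Metric.cauchySeq_iff] at hc
  obtain ⟨N, hN⟩ := hc t ht
  have h1 := hN N le_rfl (N + 1) (by simp)
  have hne : (f (φ N) : ι) ≠ f (φ (N + 1)) := by
    intro hh
    have := hφ.injective (f.injective (Subtype.ext hh))
    omega
  have h2 : ‖Q (e (f (φ N))) - Q (e (f (φ (N + 1))))‖ ^ 2
      = q (f (φ N)) ^ 2 + q (f (φ (N + 1))) ^ 2 := by
    rw [h, h]
    have := @norm_sub_sq ℂ H _ _ _ ((q (f (φ N)) : ℂ) • e (f (φ N)))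
      ((q (f (φ (N + 1))) : ℂ) • e (f (φ (N + 1))))
    rw [this]
    simp [inner_smul_left, inner_smul_right, he.2 hne, norm_smul, he.1, -Complex.coe_smul]
  have h3 : t ≤ q (f (φ N)) := (f (φ N)).2
  simp only [Function.comp, dist_eq_norm] at h1
  nlinarith [norm_nonneg (Q (e (f (φ N))) - Q (e (f (φ (N + 1)))))]

end Spectral

/-- Order the indices by decreasing `q`, ties broken by a well-ordering. Each index has finitely
many predecessors, and their number is an injective rank whose infinite range is then renumbered by
`ℕ`. -/
theorem exists_equiv_nat_antitone {ι : Type*} [Infinite ι] (q : ι → ℝ)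
    (hq : ∀ i, {j | q i ≤ q j}.Finite) : ∃ f : ℕ ≃ ι, Antitone (q ∘ f) := by
  classical
  let r : ι → ι → Prop := WellOrderingRel
  let s : ι → Set ι := fun i => {j | q i < q j ∨ (q i = q j ∧ r j i)}
  have hs : ∀ i, (s i).Finite := fun i => (hq i).subset fun j hj => by
    rcases hj with h | h
    exacts [h.le, h.1.le]
  have hlt : ∀ i j, i ∈ s j → (s i).ncard < (s j).ncard := by
    intro i j hij
    apply Set.ncard_lt_ncard _ (hs j)
    refine ⟨fun k hk => ?_, fun h => ?_⟩
    · rcases hij with h1 | h1 <;> rcases hk with h2 | h2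
      · exact Or.inl (h1.trans h2)
      · exact Or.inl (h2.1 ▸ h1)
      · exact Or.inl (h1.1 ▸ h2)
      · exact Or.inr ⟨h1.1.trans h2.1, _root_.trans h2.2 h1.2⟩
    · rcases h hij with h | h
      · exact lt_irrefl _ h
      · exact irrefl _ h.2
  have htri : ∀ i j, i ≠ j → i ∈ s j ∨ j ∈ s i := by
    intro i j hne
    rcases lt_trichotomy (q i) (q j) with h | h | h
    · exact Or.inr (Or.inl h)
    · rcases trichotomous_of r i j with h' | h' | h'
      · exact Or.inl (Or.inr ⟨h.symm, h'⟩)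
      · exact absurd h' hne
      · exact Or.inr (Or.inr ⟨h, h'⟩)
    · exact Or.inl (Or.inl h)
  let g : ι → ℕ := fun i => (s i).ncard
  have hg : Function.Injective g := by
    intro i j hij
    by_contra hne
    rcases htri i j hne with h | h
    · exact (hlt _ _ h).ne hij
    · exact (hlt _ _ h).ne hij.symm
  have : Infinite (Set.range g) := Set.infinite_coe_iff.mpr (Set.infinite_range_of_injective hg)
  let o : ℕ ≃o Set.range g := Nat.Subtype.orderIsoOfNat (Set.range g)
  refine ⟨o.toEquiv.trans (Equiv.ofInjective g hg).symm, fun m n hmn => ?_⟩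
  set i := (Equiv.ofInjective g hg).symm (o m) with hi
  set j := (Equiv.ofInjective g hg).symm (o n) with hj
  change q j ≤ q i
  have hgi : g i = o m := by simp [hi, Equiv.apply_ofInjective_symm]
  have hgj : g j = o n := by simp [hj, Equiv.apply_ofInjective_symm]
  have hle : g i ≤ g j := by
    rw [hgi, hgj]; exact o.monotone hmn
  by_contra hcon
  exact absurd (hlt j i (Or.inl (not_le.mp hcon))) (not_lt.mpr hle)

/-! ### Square roots and functional calculus on eigenvectors. -/

section Eigenvectors

variable {H : Type*} [NormedAddCommGroup H] [InnerProductSpace ℂ H] [CompleteSpace H]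

-- The vector `A v - s v` satisfies `A y = -s y`, and positivity of `A` leaves only `y = 0`.
omit [CompleteSpace H] in
theorem apply_eq_smul_of_mul_self_apply {A : H →L[ℂ] H} (hA : 0 ≤ A) {v : H} {s : ℝ} (hs : 0 < s)
    (h : A (A v) = ((s ^ 2 : ℝ) : ℂ) • v) : A v = (s : ℂ) • v := by
  have hpos := (ContinuousLinearMap.nonneg_iff_isPositive A).mp hA
  have hy : A (A v - (s : ℂ) • v) = (-s : ℂ) • (A v - (s : ℂ) • v) := by
    rw [map_sub, map_smul, h, smul_sub, smul_smul, Complex.ofReal_pow]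
    module
  have h1 := hpos.re_inner_nonneg_right (A v - (s : ℂ) • v)
  rw [hy, inner_smul_right, inner_self_eq_norm_sq_to_K] at h1
  have h2 : s * ‖A v - (s : ℂ) • v‖ ^ 2 ≤ 0 := by
    simpa [← Complex.ofReal_pow, -Complex.coe_smul] using h1
  have h3 : ‖A v - (s : ℂ) • v‖ ^ 2 ≤ 0 := nonpos_of_mul_nonpos_right h2 hs
  have h4 : ‖A v - (s : ℂ) • v‖ = 0 := by
    nlinarith [norm_nonneg (A v - (s : ℂ) • v)]
  exact sub_eq_zero.mp (norm_eq_zero.mp h4)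

/-- The functions for which the formula holds are closed under limits, sums and products and contain
the constants and the identity, hence are all continuous functions by Stone–Weierstrass. -/
theorem cfc_apply_eigenvector {A : H →L[ℂ] H} (hA : IsSelfAdjoint A) {v : H} (hv : v ≠ 0) {s : ℝ}
    (h : A v = (s : ℂ) • v) (f : ℝ → ℝ) (hf : ContinuousOn f (spectrum ℝ A)) :
    cfc f A v = (f s : ℂ) • v := by
  have hs : s ∈ spectrum ℝ A := by
    rw [spectrum.mem_iff]
    intro hu
    obtain ⟨u, hu⟩ := hu
    apply hv
    have h1 : (u : H →L[ℂ] H) v = 0 := by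
      rw [hu]
      simp [h, Algebra.algebraMap_eq_smul_one]
    have h2 : ((↑u⁻¹ : H →L[ℂ] H) * u) v = v := by simp
    rw [← h2, mul_apply_eq_comp, h1, map_zero]
  rw [cfc_apply f A hA hf]
  suffices H : ∀ g : C(spectrum ℝ A, ℝ), cfcHom hA g v = (g ⟨s, hs⟩ : ℂ) • v by
    rw [H]; rfl
  intro g
  induction g using ContinuousMap.induction_on_of_compact (𝕜 := ℝ) with
  | const r =>
    have : (ContinuousMap.const (spectrum ℝ A) r) = algebraMap ℝ C(spectrum ℝ A, ℝ) r := rfl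
    rw [this, AlgHomClass.commutes]
    simp [Algebra.algebraMap_eq_smul_one]
  | id =>
    have := cfcHom_id (R := ℝ) hA
    change (cfcHom hA (ContinuousMap.restrict (spectrum ℝ A) (ContinuousMap.id ℝ))) v = _
    rw [this, h]
    rfl
  | star_id =>
    have : star (ContinuousMap.restrict (spectrum ℝ A) (ContinuousMap.id ℝ))
      = ContinuousMap.restrict (spectrum ℝ A) (ContinuousMap.id ℝ) := by
      ext; simp
    rw [this, cfcHom_id (R := ℝ) hA, h]
    rfl
  | add f g hf hg =>
    rw [map_add, add_apply, hf, hg]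
    simp [add_smul]
  | mul f g hf hg =>
    rw [map_mul, mul_apply_eq_comp, hg, map_smul, hf, smul_smul]
    simp [mul_comm]
  | frequently f hf =>
    have hcl : IsClosed {g : C(spectrum ℝ A, ℝ) | cfcHom hA g v = (g ⟨s, hs⟩ : ℂ) • v} := by
      apply isClosed_eq
      · exact (ContinuousLinearMap.apply ℂ H v).continuous.comp (cfcHom_continuous hA)
      · exact (Complex.continuous_ofReal.comp (continuous_eval_const _)).smul continuous_const
    exact hcl.mem_of_frequently_of_tendsto hf tendsto_id
  | _ => infer_instance

theorem rpow_apply_eigenvector {A : H →L[ℂ] H} (hA : 0 ≤ A) {v : H} {s d : ℝ} (hd : 0 < d)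
    (h : A v = (s : ℂ) • v) : (A ^ d) v = ((s ^ d : ℝ) : ℂ) • v := by
  rcases eq_or_ne v 0 with rfl | hv
  · simp
  rw [CFC.rpow_eq_cfc_real hA]
  exact cfc_apply_eigenvector hA.isSelfAdjoint hv h _
    (Real.continuous_rpow_const hd.le).continuousOn

end Eigenvectors

/-! ### Singular values and compactness of diagonal operators. -/

section SingularValues

variable {H : Type*} [NormedAddCommGroup H] [InnerProductSpace ℂ H] [CompleteSpace H]
  {e : HilbertBasis ℕ ℂ H} {T : H →L[ℂ] H} {a : ℕ → ℝ}

omit [CompleteSpace H] in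
theorem eigenvalueCount_le_of_diagonal (hT : ∀ i, T (e i) = (a i : ℂ) • e i) (ha : Antitone a)
    {n : ℕ} {t : ℝ} (ht : a n ≤ t) : eigenvalueCount T t ≤ n := by
  have hsub : (⨆ s ∈ Set.Ioi t, Module.End.eigenspace (T : H →ₗ[ℂ] H) (s : ℂ)) ≤
      Submodule.span ℂ (Set.range fun i : Fin n => e i) := by
    refine iSup₂_le fun s hs x hx => ?_
    have hx : T x = (s : ℂ) • x := Module.End.mem_eigenspace_iff.mp hx
    have hsum : x = ∑ i ∈ Finset.range n, inner ℂ (e i) x • e i := by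
      rw [← sub_eq_zero]
      apply e.eq_zero_of_inner_eq_zero
      intro k
      rw [inner_sub_right, inner_sum]
      simp only [inner_smul_right, orthonormal_iff_ite.mp e.orthonormal]
      by_cases hk : k < n
      · simp [hk]
      · have h1 := inner_apply_of_diagonal hT x k
        rw [hx, inner_smul_right] at h1
        have h2 : a k < s := (ha (not_lt.mp hk)).trans_lt (ht.trans_lt hs)
        have h3 : ((s : ℂ) - a k) * inner ℂ (e k) x = 0 := by rw [sub_mul, h1, sub_self]
        have h4 : (s : ℂ) - a k ≠ 0 := by
          rw [← Complex.ofReal_sub, Complex.ofReal_ne_zero]; linarith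
        simp [hk, (mul_eq_zero.mp h3).resolve_left h4]
    rw [hsum]
    exact Submodule.sum_mem _ fun i hi => Submodule.smul_mem _ _
      (Submodule.subset_span ⟨⟨i, Finset.mem_range.mp hi⟩, rfl⟩)
  refine (Submodule.rank_mono hsub).trans ((rank_span_le _).trans ?_)
  have := Cardinal.mk_range_le_lift (f := fun i : Fin n => e i)
  simpa using this

omit [CompleteSpace H] in
theorem le_eigenvalueCount_of_diagonal (hT : ∀ i, T (e i) = (a i : ℂ) • e i) (ha : Antitone a)
    {n : ℕ} {t : ℝ} (ht : t < a n) : ((n + 1 : ℕ) : Cardinal) ≤ eigenvalueCount T t := by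
  have hsub : Submodule.span ℂ (Set.range fun i : Fin (n + 1) => e i) ≤
      (⨆ s ∈ Set.Ioi t, Module.End.eigenspace (T : H →ₗ[ℂ] H) (s : ℂ)) := by
    rw [Submodule.span_le]
    rintro _ ⟨i, rfl⟩
    have hi : a i ∈ Set.Ioi t := ht.trans_le (ha (Nat.lt_succ_iff.mp i.2))
    exact Submodule.mem_iSup_of_mem (a i) (Submodule.mem_iSup_of_mem hi
      (Module.End.mem_eigenspace_iff.mpr (hT i)))
  refine le_trans ?_ (Submodule.rank_mono hsub)
  rw [rank_span]
  · have := Cardinal.mk_range_eq_of_injective (f := fun i : Fin (n + 1) => e i)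
      (e.orthonormal.linearIndependent.injective.comp Fin.val_injective)
    simp at this
    simp [this]
  · exact e.orthonormal.linearIndependent.comp _ Fin.val_injective

/-- The thresholds exceeded by fewer than `n + 1` eigenvalues form the half-line from `a n`. The
basis is numbered from `0` and the singular values from `1`, whence the shift. -/
theorem singularValue_of_diagonal (hT : ∀ i, T (e i) = (a i : ℂ) • e i) (ha : Antitone a)
    (ha0 : ∀ i, 0 ≤ a i) (n : ℕ) : singularValue T (n + 1) = a n := by
  have habs : CFC.abs T = T := CFC.abs_of_nonneg T (nonneg_of_diagonal hT ha0)
  have hset : {t : ℝ | 0 ≤ t ∧ eigenvalueCount (CFC.abs T) t < ((n + 1 : ℕ) : Cardinal)}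
      = Set.Ici (a n) := by
    ext t
    rw [habs]
    constructor
    · rintro ⟨-, h⟩
      by_contra hlt
      exact absurd h (not_lt.mpr (le_eigenvalueCount_of_diagonal hT ha (not_le.mp hlt)))
    · intro h
      exact ⟨(ha0 n).trans h, (eigenvalueCount_le_of_diagonal hT ha h).trans_lt
        (by exact_mod_cast Nat.lt_succ_self n)⟩
  rw [singularValue, hset, csInf_Ici]

theorem singularValue_eq_zero_of_finrank_lt [FiniteDimensional ℂ H] (T : H →L[ℂ] H) {n : ℕ}
    (hn : Module.finrank ℂ H < n) : singularValue T n = 0 := by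
  have hset : {t : ℝ | 0 ≤ t ∧ eigenvalueCount (CFC.abs T) t < (n : Cardinal)} = Set.Ici 0 := by
    ext t
    refine ⟨fun h => h.1, fun h => ⟨h, ?_⟩⟩
    refine (Submodule.rank_le _).trans_lt ?_
    rw [← Module.finrank_eq_rank]
    exact_mod_cast hn
  rw [singularValue, hset, csInf_Ici]

omit [CompleteSpace H] in
theorem isCompactOperator_rankOne (x y : H) :
    IsCompactOperator (InnerProductSpace.rankOne ℂ x y) := by
  rw [InnerProductSpace.rankOne_def']
  exact (isCompactOperator_of_locallyCompactSpace_rng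
    (ContinuousLinearMap.toSpanSingleton ℂ x)).comp_clm (innerSL ℂ y)

theorem isCompactOperator_of_diagonal (hT : ∀ i, T (e i) = (a i : ℂ) • e i)
    (ha0 : ∀ i, 0 ≤ a i) (ha : Antitone a) (hlim : Tendsto a atTop (𝓝 0)) :
    IsCompactOperator T := by
  classical
  let F : ℕ → H →L[ℂ] H := fun n =>
    ∑ i ∈ Finset.range n, (a i : ℂ) • (InnerProductSpace.rankOne ℂ (e i) (e i))
  have hF : ∀ n k, F n (e k) = ((if k < n then a k else 0 : ℝ) : ℂ) • e k := by
    intro n k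
    simp only [F, sum_apply, smul_apply,
      InnerProductSpace.rankOne_apply, orthonormal_iff_ite.mp e.orthonormal]
    simp [ite_smul]
  have hFc : ∀ n, IsCompactOperator (F n) := by
    intro n
    have : F n ∈ compactOperator (RingHom.id ℂ) H H :=
      Submodule.sum_mem _ fun i _ => Submodule.smul_mem _ _ (isCompactOperator_rankOne _ _)
    exact this
  refine isCompactOperator_of_tendsto (l := atTop) (F := F) ?_ (Eventually.of_forall hFc)
  rw [tendsto_iff_norm_sub_tendsto_zero]
  -- The finite rank truncations converge in norm because `0 ≤ T - F n ≤ a n`.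
  refine squeeze_zero (fun _ => norm_nonneg _) (fun n => ?_) hlim
  have h1 : 0 ≤ T - F n := by
    refine nonneg_of_diagonal (e := e) (a := fun k => if k < n then 0 else a k) (fun k => ?_) ?_
    · rw [sub_apply, hT, hF]
      split_ifs <;> simp
    · intro k; split_ifs <;> simp [ha0]
  have h2 : T - F n ≤ (a n : ℂ) • 1 := by
    rw [← sub_nonneg]
    refine nonneg_of_diagonal (e := e) (a := fun k => if k < n then a n else a n - a k)
      (fun k => ?_) ?_
    · rw [sub_apply, sub_apply, hT, hF]
      split_ifs <;> simp [sub_smul]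
    · intro k; split_ifs with h
      · exact ha0 n
      · exact sub_nonneg.mpr (ha (not_lt.mp h))
  rw [norm_sub_rev]
  refine (CStarAlgebra.norm_le_norm_of_nonneg_of_le h1 h2).trans ?_
  rw [norm_smul]
  have : ‖(1 : H →L[ℂ] H)‖ ≤ 1 := ContinuousLinearMap.norm_id_le
  simp only [Complex.norm_real, Real.norm_eq_abs, abs_of_nonneg (ha0 n)]
  nlinarith [ha0 n]

end SingularValues

/-! ### Diagonalization of the inverse Dirac operator. -/

namespace SpectralTriple

variable {𝓐 H : Type*} [NonUnitalRing 𝓐] [Module ℂ 𝓐]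
    [IsScalarTower ℂ 𝓐 𝓐] [SMulCommClass ℂ 𝓐 𝓐]
  [NormedAddCommGroup H] [InnerProductSpace ℂ H] [CompleteSpace H]

theorem isCompactOperator_Dinv (S : SpectralTriple 𝓐 H) : IsCompactOperator S.Dinv :=
  S.exists_inverse.choose_spec.2

theorem Dinv_eq_zero (S : SpectralTriple 𝓐 H) {x : H} (hx : S.Dinv x = 0) : x = 0 := by
  obtain ⟨hy, h⟩ := S.exists_inverse.choose_spec.1.1 x
  change S.D ⟨S.Dinv x, hy⟩ - (0 : ℂ) • S.Dinv x = x at h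
  have h0 : (⟨S.Dinv x, hy⟩ : S.D.domain) = 0 := Subtype.ext hx
  rw [h0, LinearPMap.map_zero, zero_smul, sub_zero] at h
  exact h.symm

theorem abs_absDinv (S : SpectralTriple 𝓐 H) : CFC.abs S.absDinv = CFC.abs S.Dinv :=
  CFC.cfcAbs_cfcAbs _

theorem singularValue_absDinv (S : SpectralTriple 𝓐 H) :
    singularValue S.absDinv = singularValue S.Dinv := by
  funext n
  rw [singularValue, abs_absDinv, singularValue]

theorem absDinv_nonneg (S : SpectralTriple 𝓐 H) : 0 ≤ S.absDinv := CFC.abs_nonneg _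

theorem exists_diagonalization (S : SpectralTriple 𝓐 H) (hH : ¬ FiniteDimensional ℂ H) :
    ∃ (e : HilbertBasis ℕ ℂ H) (a : ℕ → ℝ), (∀ i, S.absDinv (e i) = (a i : ℂ) • e i) ∧
      (∀ i, 0 < a i) ∧ Antitone a ∧ Tendsto a atTop (𝓝 0) := by
  set R := S.Dinv with hR
  -- The square `R* R` is visibly compact and positive; its eigenvectors are eigenvectors of `|R|`
  -- with the square roots as eigenvalues. Injectivity of `R` excludes the eigenvalue `0`, so a
  -- single decreasing enumeration reaches the whole basis.
  set Q : H →L[ℂ] H := star R * R with hQ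
  have hQc : IsCompactOperator Q := S.isCompactOperator_Dinv.clm_comp (star R)
  have hQ0 : 0 ≤ Q := star_mul_self_nonneg R
  obtain ⟨ι, e, q, he⟩ := exists_hilbertBasis_eigenvectors hQc hQ0
  have hne : ∀ i, e i ≠ 0 := fun i h => by simpa [h] using e.orthonormal.1 i
  have hq : ∀ i, 0 < q i := by
    intro i
    have h1 : inner ℂ (e i) (Q (e i)) = ((‖R (e i)‖ ^ 2 : ℝ) : ℂ) := by
      rw [hQ, mul_apply_eq_comp, ContinuousLinearMap.star_eq_adjoint,
        ContinuousLinearMap.adjoint_inner_right, inner_self_eq_norm_sq_to_K]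
      simp
    rw [he, inner_smul_right, inner_self_eq_norm_sq_to_K, e.orthonormal.1] at h1
    have h2 : q i = ‖R (e i)‖ ^ 2 := by
      apply Complex.ofReal_injective
      simpa using h1
    rw [h2]
    have : R (e i) ≠ 0 := fun h => hne i (S.Dinv_eq_zero h)
    positivity
  have hfin : ∀ t, 0 < t → {i | t ≤ q i}.Finite := fun t ht =>
    finite_setOf_le_eigenvalue e.orthonormal hQc he ht
  have hinf : Infinite ι := by
    by_contra hf
    rw [not_infinite_iff_finite] at hf
    have := Fintype.ofFinite ι
    apply hH
    have hfin : (Set.range e).Finite := Set.finite_range e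
    have h1 := e.dense_span
    have : FiniteDimensional ℂ (Submodule.span ℂ (Set.range e)) :=
      FiniteDimensional.span_of_finite ℂ hfin
    rw [(Submodule.closed_of_finiteDimensional _).submodule_topologicalClosure_eq] at h1
    rw [h1] at this
    exact (Submodule.topEquiv (R := ℂ) (M := H)).finiteDimensional
  obtain ⟨f, hf⟩ := exists_equiv_nat_antitone q (fun i => hfin _ (hq i))
  have hf0 : Tendsto (q ∘ f) atTop (𝓝 0) := by
    rw [Metric.tendsto_atTop]
    intro ε hε
    have h1 : {n | ε ≤ q (f n)}.Finite := (hfin ε hε).preimage (f := f) f.injective.injOn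
    obtain ⟨N, hN⟩ := h1.bddAbove
    refine ⟨N + 1, fun n hn => ?_⟩
    simp only [Function.comp, Real.dist_eq, sub_zero, abs_of_pos (hq _)]
    by_contra hcon
    have := hN (not_lt.mp hcon)
    omega
  have hon : Orthonormal ℂ (e ∘ f) := e.orthonormal.comp f f.injective
  have hbot : (Submodule.span ℂ (Set.range (e ∘ f)))ᗮ = ⊥ := by
    rw [f.surjective.range_comp, ← Submodule.topologicalClosure_eq_top_iff]
    exact e.dense_span
  refine ⟨HilbertBasis.mkOfOrthogonalEqBot hon hbot, fun n => √(q (f n)), fun i => ?_,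
    fun i => Real.sqrt_pos.mpr (hq _), fun m n hmn => Real.sqrt_le_sqrt (hf hmn), ?_⟩
  · rw [HilbertBasis.coe_mkOfOrthogonalEqBot]
    apply apply_eq_smul_of_mul_self_apply S.absDinv_nonneg (Real.sqrt_pos.mpr (hq _))
    rw [Real.sq_sqrt (hq _).le]
    have := congrArg (fun T : H →L[ℂ] H => T (e (f i))) (CFC.abs_mul_abs R)
    exact this.trans (he (f i))
  · have := (Real.continuous_sqrt.tendsto 0).comp hf0
    rwa [Real.sqrt_zero] at this

end SpectralTriple

/-- The sequence `l` decays like `n ^ (-s)`, in the sense that the average logarithmic slope over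
long intervals is uniformly close to `-s`. -/
def RegularDecay (l : ℕ → ℝ) (s : ℝ) : Prop :=
  ∀ ε > 0, ∀ᶠ N : ℕ in atTop, ∀ᶠ n : ℕ in atTop,
    (N : ℝ) ^ (-(s + ε)) * l n ≤ l (N * n) ∧ l (N * n) ≤ (N : ℝ) ^ (-(s - ε)) * l n

/-! ### Sequences of regular decay. -/

namespace RegularDecay

variable {l : ℕ → ℝ} {s : ℝ}

theorem rpow (h : RegularDecay l s) (hl : ∀ n, 0 < l n) {α : ℝ} (hα : 0 < α) :
    RegularDecay (fun n => l n ^ α) (s * α) := by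
  intro ε hε
  filter_upwards [h (ε / α) (by positivity)] with N hN
  filter_upwards [hN] with n hn
  have e1 : ((N : ℝ) ^ (-(s + ε / α))) ^ α = (N : ℝ) ^ (-(s * α + ε)) := by
    rw [← Real.rpow_mul (Nat.cast_nonneg _)]; congr 1; field_simp
  have e2 : ((N : ℝ) ^ (-(s - ε / α))) ^ α = (N : ℝ) ^ (-(s * α - ε)) := by
    rw [← Real.rpow_mul (Nat.cast_nonneg _)]; congr 1; field_simp
  constructor
  · rw [← e1, ← Real.mul_rpow (by positivity) (hl n).le]
    exact Real.rpow_le_rpow (mul_nonneg (by positivity) (hl n).le) hn.1 hα.le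
  · rw [← e2, ← Real.mul_rpow (by positivity) (hl n).le]
    exact Real.rpow_le_rpow (hl _).le hn.2 hα.le

/-- With `ε = (s - 1) / 2` the dilation factor times `N` is `N ^ (-ε)`, which is small for large
`N`. -/
theorem exists_contraction (h : RegularDecay l s) (hl : Antitone l)
    (hs : 1 < s) : ∃ M : ℕ, 2 ≤ M ∧ ∃ r : ℝ, 0 < r ∧ r * M < 1 ∧
      ∀ᶠ k : ℕ in atTop, l (k + 1) ≤ r * l (k / M + 1) := by
  set ε := (s - 1) / 2 with hε
  have hε0 : 0 < ε := by rw [hε]; linarith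
  have hlim : Tendsto (fun N : ℕ => (N : ℝ) ^ (-ε)) atTop (𝓝 0) :=
    (tendsto_rpow_neg_atTop hε0).comp tendsto_natCast_atTop_atTop
  obtain ⟨N, hN, hN1, hN2⟩ := ((h ε hε0).and ((eventually_ge_atTop 1).and
    (hlim.eventually (gt_mem_nhds (show (0 : ℝ) < 1 / 4 by norm_num))))).exists
  obtain ⟨n0, hn0⟩ := eventually_atTop.mp hN
  have hNpos : (0 : ℝ) < N := by exact_mod_cast hN1
  have hN1' : (1 : ℝ) ≤ N := by exact_mod_cast hN1
  have hr : (N : ℝ) ^ (-(s - ε)) * N = (N : ℝ) ^ (-ε) := by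
    rw [← Real.rpow_add_one hNpos.ne']; congr 1; rw [hε]; ring
  -- The choice `M = N + 1` leaves room for rounding: `N * (k / M + 1) ≤ k + 1` once `k / M ≥ N`.
  -- The bound `1/4` pays for replacing `N` by `N + 1`.
  refine ⟨N + 1, by omega, (N : ℝ) ^ (-(s - ε)), by positivity, ?_, ?_⟩
  · have h0 : (0 : ℝ) < (N : ℝ) ^ (-(s - ε)) := by positivity
    push_cast
    nlinarith
  · filter_upwards [eventually_ge_atTop ((N + 1) * (N + n0))] with k hk
    have h1 : N + n0 ≤ k / (N + 1) := (Nat.le_div_iff_mul_le (by omega)).mpr (by rwa [mul_comm])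
    have h2 := Nat.div_mul_le_self k (N + 1)
    refine le_trans (hl ?_) (hn0 (k / (N + 1) + 1) (by omega)).2
    nlinarith

theorem exists_expansion (h : RegularDecay l s) (hl : Antitone l)
    (hs : s < 1) : ∃ M : ℕ, 2 ≤ M ∧ ∃ r : ℝ, 0 < r ∧ 1 < r * M ∧
      ∀ᶠ k : ℕ in atTop, r * l (k / M + 1) ≤ l (k + 1) := by
  set ε := (1 - s) / 2 with hε
  have hε0 : 0 < ε := by rw [hε]; linarith
  obtain ⟨N, hN, hN1⟩ := ((h ε hε0).and (eventually_ge_atTop 2)).exists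
  obtain ⟨n0, hn0⟩ := eventually_atTop.mp hN
  have hN1' : (2 : ℝ) ≤ N := by exact_mod_cast hN1
  have hNpos : (0 : ℝ) < N := by linarith
  refine ⟨N, hN1, (N : ℝ) ^ (-(s + ε)), by positivity, ?_, ?_⟩
  · rw [← Real.rpow_add_one hNpos.ne']
    exact Real.one_lt_rpow (by linarith) (by rw [hε]; linarith)
  · filter_upwards [eventually_ge_atTop (N * n0)] with k hk
    have h1 : n0 ≤ k / N := (Nat.le_div_iff_mul_le (by omega)).mpr (by rwa [mul_comm])
    refine (hn0 (k / N + 1) (by omega)).1.trans (hl ?_)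
    have := Nat.lt_mul_div_succ k (show 0 < N by omega)
    omega

/-- A fixed large `N ≥ 2` controls halving, since `m + 1 ≤ N * (m / 2 + 1)`; the finitely many small
indices go into the constant. This makes domination by the sequence stable under sums of operators.
-/
theorem exists_doubling (h : RegularDecay l s) (hl : Antitone l) (hl0 : ∀ n, 0 < l n) :
    ∃ C : ℝ, 0 < C ∧ ∀ m : ℕ, l (m / 2 + 1) ≤ C * l (m + 1) := by
  obtain ⟨N, hN, hN1⟩ := ((h 1 one_pos).and (eventually_ge_atTop 2)).exists
  obtain ⟨n0, hn0⟩ := eventually_atTop.mp hN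
  have hNpos : (0 : ℝ) < N := by exact_mod_cast (by omega : 0 < N)
  set r := (N : ℝ) ^ (-(s + 1)) with hr
  have hr0 : 0 < r := by positivity
  have hm : ∀ m : ℕ, m + 1 ≤ N * (m / 2 + 1) := fun m => by
    have := Nat.mul_le_mul_right (m / 2 + 1) hN1
    omega
  refine ⟨max r⁻¹ (l 0 / l (N * n0 + 1)), lt_max_of_lt_left (by positivity), fun m => ?_⟩
  rcases le_or_gt n0 (m / 2 + 1) with h1 | h1
  · refine le_trans ?_ (mul_le_mul_of_nonneg_right (le_max_left _ _) (hl0 _).le)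
    rw [le_inv_mul_iff₀ hr0]
    exact (hn0 _ h1).1.trans (hl (hm m))
  · refine le_trans ?_ (mul_le_mul_of_nonneg_right (le_max_right _ _) (hl0 _).le)
    rw [div_mul_eq_mul_div, le_div_iff₀ (hl0 _)]
    refine mul_le_mul (hl (Nat.zero_le _)) (hl ?_) (hl0 _).le (hl0 _).le
    have := hm m
    have := Nat.mul_le_mul_left N h1.le
    omega

/-- Half of `log₂ b` is taken as the tolerance in the decay exponent. Over `p` doublings the error
factor `G` is then only the square root of `b ^ p`, and this gap gives the contradictions below. -/
theorem exists_dyadic_scale (h : RegularDecay l s) {b : ℝ} (hb : 1 < b) (n₀ : ℕ) :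
    ∃ p n : ℕ, 1 ≤ p ∧ n₀ ≤ n ∧ 1 ≤ n ∧ ∃ G : ℝ, 1 < G ∧ b ^ p = G * G ∧ ∀ k : ℕ,
      ((2 : ℝ) ^ p) ^ (-s) * l ((2 ^ p) ^ k * n) ≤ G * l ((2 ^ p) ^ (k + 1) * n) ∧
      l ((2 ^ p) ^ (k + 1) * n) ≤ G * ((2 : ℝ) ^ p) ^ (-s) * l ((2 ^ p) ^ k * n) := by
  set δ := Real.logb 2 b / 2 with hδ
  have hδ0 : 0 < δ := by rw [hδ]; have := Real.logb_pos one_lt_two hb; positivity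
  have hlim : Tendsto (fun p : ℕ => 2 ^ p) atTop atTop := tendsto_pow_atTop_atTop_of_one_lt one_lt_two
  obtain ⟨p, hp, hp1⟩ := ((hlim.eventually (h δ hδ0)).and (eventually_ge_atTop 1)).exists
  obtain ⟨n1, hn1⟩ := eventually_atTop.mp hp
  push_cast at hn1
  have hP : (0 : ℝ) < 2 ^ p := by positivity
  have hGpos : 0 < ((2 : ℝ) ^ p) ^ δ := by positivity
  refine ⟨p, max n₀ (max n1 1), hp1, le_max_left _ _, by simp, ((2 : ℝ) ^ p) ^ δ, ?_, ?_, ?_⟩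
  · exact Real.one_lt_rpow (one_lt_pow₀ one_lt_two (by omega)) hδ0
  · rw [← Real.rpow_add hP, hδ, add_halves, ← Real.rpow_natCast 2 p, ← Real.rpow_mul (by norm_num),
      mul_comm, Real.rpow_mul (by norm_num), Real.rpow_logb (by norm_num) (by norm_num) (by linarith),
      Real.rpow_natCast]
  · intro k
    have hk : n1 ≤ (2 ^ p) ^ k * max n₀ (max n1 1) :=
      le_trans (by simp) (Nat.le_mul_of_pos_left _ (by positivity))
    have h1 := hn1 _ hk
    have e1 : ((2 : ℝ) ^ p) ^ (-(s + δ)) = ((2 : ℝ) ^ p) ^ (-s) / ((2 : ℝ) ^ p) ^ δ := by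
      rw [← Real.rpow_sub hP]; congr 1; ring
    have e2 : ((2 : ℝ) ^ p) ^ (-(s - δ)) = ((2 : ℝ) ^ p) ^ δ * ((2 : ℝ) ^ p) ^ (-s) := by
      rw [← Real.rpow_add hP]; congr 1; ring
    rw [e1, e2, ← mul_assoc, ← pow_succ'] at h1
    refine ⟨?_, h1.2⟩
    have h2 := h1.1
    rwa [div_mul_eq_mul_div, div_le_iff₀ hGpos, mul_comm (l _)] at h2

/-- If `m * l m > ε * w m` from some point on, each doubling multiplies `w` by at least `1 + ε / 2`.
Over `p` doublings `w` gains `G²` while `m * l m` gains at most `G`, so `m * l m` cannot stay above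
`ε * w m`. -/
theorem frequently_le_of_increments (h : RegularDecay l 1) (hl0 : ∀ n, 0 < l n)
    {w : ℕ → ℝ} (hw0 : ∀ n, 1 ≤ n → 0 < w n) (hw : ∀ n, w n + n * l (2 * n) ≤ w (2 * n))
    {ε : ℝ} (hε : 0 < ε) : ∃ᶠ m : ℕ in atTop, m * l m ≤ ε * w m := by
  intro hcon
  obtain ⟨n0, hn0⟩ := eventually_atTop.mp hcon
  simp only [not_le] at hn0
  have hstep : ∀ n, max n0 1 ≤ n → (1 + ε / 2) * w n ≤ w (2 * n) := by
    intro n hn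
    have hn1 : n0 ≤ n := le_trans (le_max_left _ _) hn
    have h1 := hn0 (2 * n) (by omega)
    have h2 := hw n
    have h3 := mul_pos (show (0 : ℝ) < n by
      exact_mod_cast lt_of_lt_of_le one_pos (le_trans (le_max_right n0 1) hn)) (hl0 (2 * n))
    push_cast at h1
    nlinarith
  obtain ⟨p, n, hp, hn, hn1, G, hG, hbG, hk⟩ :=
    h.exists_dyadic_scale (show 1 < 1 + ε / 2 by linarith) (max n0 1)
  have hw2 : ∀ j, (1 + ε / 2) ^ j * w n ≤ w (2 ^ j * n) := by
    intro j
    induction j with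
    | zero => simp
    | succ j ih =>
      have := hstep (2 ^ j * n) (hn.trans (Nat.le_mul_of_pos_left _ (by positivity)))
      rw [pow_succ', mul_assoc, pow_succ', mul_assoc]
      exact le_trans (mul_le_mul_of_nonneg_left ih (by positivity)) this
  have hP : (0 : ℝ) < 2 ^ p := by positivity
  have hl2 : ∀ k : ℕ, (((2 ^ p) ^ k * n : ℕ) : ℝ) * l ((2 ^ p) ^ k * n) ≤ G ^ k * (n * l n) := by
    intro k
    induction k with
    | zero => simp
    | succ k ih =>
      have h1 := (hk k).2
      rw [Real.rpow_neg_one] at h1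
      calc (((2 ^ p) ^ (k + 1) * n : ℕ) : ℝ) * l ((2 ^ p) ^ (k + 1) * n)
          ≤ (((2 ^ p) ^ (k + 1) * n : ℕ) : ℝ) * (G * (2 ^ p)⁻¹ * l ((2 ^ p) ^ k * n)) := by gcongr
        _ = G * ((((2 ^ p) ^ k * n : ℕ) : ℝ) * l ((2 ^ p) ^ k * n)) := by
            push_cast; field_simp; ring
        _ ≤ G * (G ^ k * (n * l n)) := by gcongr
        _ = _ := by ring
  have hfin : ∀ k : ℕ, G ^ k * (ε * w n) ≤ n * l n := by
    intro k
    have h1 := hw2 (p * k)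
    rw [pow_mul, hbG, pow_mul] at h1
    have h2 := hn0 ((2 ^ p) ^ k * n) (le_trans (le_trans (le_max_left _ _) hn)
      (Nat.le_mul_of_pos_left _ (by positivity)))
    have h3 : ε * ((G * G) ^ k * w n) ≤ G ^ k * (n * l n) :=
      (mul_le_mul_of_nonneg_left h1 hε.le).trans (h2.le.trans (hl2 k))
    have hGk : 0 < G ^ k := by positivity
    rw [mul_pow] at h3
    refine le_of_mul_le_mul_left ?_ hGk
    linarith
  have hpos : 0 < ε * w n := mul_pos hε (hw0 n hn1)
  obtain ⟨k, hk'⟩ := pow_unbounded_of_one_lt (n * l n / (ε * w n)) hG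
  rw [div_lt_iff₀ hpos] at hk'
  exact absurd (hfin k) (not_le.mpr hk')

/-- Tail version of the same argument: `w` would lose a factor `G²` over `p` doublings while `m * l
m` loses at most `G`, yet `w x` must still dominate `x * l (2 * x)`. -/
theorem frequently_le_of_decrements (h : RegularDecay l 1) (hl : Antitone l) (hl0 : ∀ n, 0 < l n)
    {w : ℕ → ℝ} (hw0 : ∀ n, 0 ≤ w n) (hw : ∀ n, w (2 * n) + n * l (2 * n) ≤ w n)
    {ε : ℝ} (hε : 0 < ε) : ∃ᶠ m : ℕ in atTop, m * l m ≤ ε * w m := by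
  intro hcon
  obtain ⟨n0, hn0⟩ := eventually_atTop.mp hcon
  simp only [not_le] at hn0
  have hstep : ∀ n, n0 ≤ n → (1 + ε / 2) * w (2 * n) ≤ w n := by
    intro n hn
    have h1 := hn0 (2 * n) (by omega)
    have h2 := hw n
    push_cast at h1
    nlinarith
  obtain ⟨p, n, hp, hn, hn1, G, hG, hbG, hk⟩ :=
    h.exists_dyadic_scale (show 1 < 1 + ε / 2 by linarith) n0
  have hw2 : ∀ j, (1 + ε / 2) ^ j * w (2 ^ j * n) ≤ w n := by
    intro j
    induction j with
    | zero => simp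
    | succ j ih =>
      have := hstep (2 ^ j * n) (hn.trans (Nat.le_mul_of_pos_left _ (by positivity)))
      rw [pow_succ, mul_assoc, pow_succ', mul_assoc]
      exact le_trans (mul_le_mul_of_nonneg_left this (by positivity)) ih
  have hP : (0 : ℝ) < 2 ^ p := by positivity
  have hl2 : ∀ k : ℕ, n * l n ≤ G ^ k * ((((2 ^ p) ^ k * n : ℕ) : ℝ) * l ((2 ^ p) ^ k * n)) := by
    intro k
    induction k with
    | zero => simp
    | succ k ih =>
      have h1 := (hk k).1
      rw [Real.rpow_neg_one] at h1
      calc n * l n ≤ G ^ k * ((((2 ^ p) ^ k * n : ℕ) : ℝ) * l ((2 ^ p) ^ k * n)) := ih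
        _ = G ^ k * ((((2 ^ p) ^ (k + 1) * n : ℕ) : ℝ) * ((2 ^ p)⁻¹ * l ((2 ^ p) ^ k * n))) := by
            push_cast; field_simp; ring
        _ ≤ G ^ k * ((((2 ^ p) ^ (k + 1) * n : ℕ) : ℝ) * (G * l ((2 ^ p) ^ (k + 1) * n))) := by
            gcongr
        _ = _ := by ring
  have hpos : 0 < n * l n := mul_pos (by exact_mod_cast hn1) (hl0 n)
  have hfin : ∀ k : ℕ, G ^ k * (n * l n) ≤ G * 2 ^ p * w n := by
    intro k
    set x := (2 ^ p) ^ k * n with hx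
    have h1 := hw2 (p * k)
    rw [pow_mul, hbG, pow_mul, ← hx] at h1
    -- One more scale is used so that `l (2 ^ p * x) ≤ l (2 * x)`, which the decrement at `x` bounds
    -- by `w x / x`.
    have h2 := hl2 (k + 1)
    have hx1 : (2 ^ p) ^ (k + 1) * n = 2 ^ p * x := by rw [hx]; ring
    rw [hx1] at h2
    have h3 : l (2 ^ p * x) ≤ l (2 * x) := hl (Nat.mul_le_mul_right _ (by
      calc 2 = 2 ^ 1 := rfl
        _ ≤ 2 ^ p := Nat.pow_le_pow_right (by norm_num) hp))
    have h4 : x * l (2 * x) ≤ w x := by linarith [hw x, hw0 (2 * x)]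
    have hGk : 0 < G ^ k := by positivity
    calc G ^ k * (n * l n) ≤ G ^ k * (G ^ (k + 1) * (((2 ^ p * x : ℕ) : ℝ) * l (2 ^ p * x))) := by
            gcongr
      _ ≤ G ^ k * (G ^ (k + 1) * (((2 ^ p * x : ℕ) : ℝ) * l (2 * x))) := by gcongr
      _ = G * 2 ^ p * (G * G) ^ k * (x * l (2 * x)) := by push_cast; rw [mul_pow]; ring
      _ ≤ G * 2 ^ p * (G * G) ^ k * w x := by gcongr
      _ = G * 2 ^ p * ((G * G) ^ k * w x) := by ring
      _ ≤ _ := by gcongr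
  obtain ⟨k, hk'⟩ := pow_unbounded_of_one_lt (G * 2 ^ p * w n / (n * l n)) hG
  rw [div_lt_iff₀ hpos] at hk'
  exact absurd (hfin k) (not_le.mpr hk')

end RegularDecay

/-! ### Partial sums of sequences compared with their dilations. -/

section PartialSums

variable {a : ℕ → ℝ}

theorem sum_range_mul_div (a : ℕ → ℝ) {M : ℕ} (hM : 0 < M) (K : ℕ) :
    ∑ k ∈ Finset.range (M * K), a (k / M) = M * ∑ k ∈ Finset.range K, a k := by
  induction K with
  | zero => simp
  | succ K ih =>
    rw [Nat.mul_succ, Finset.sum_range_add, ih, Finset.sum_range_succ, mul_add]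
    congr 1
    rw [Finset.sum_congr rfl (g := fun _ => a K)]
    · simp
    · intro j hj
      rw [Nat.mul_add_div hM, Nat.div_eq_of_lt (Finset.mem_range.mp hj), add_zero]

/-- Writing `S` for the partial sums, `S n ≤ S (M n) ≤ B + r M * S n`, and `r M < 1` lets `S n` be
absorbed on the left. -/
theorem exists_sum_range_le_of_contraction (ha0 : ∀ n, 0 ≤ a n) {M : ℕ}
    (hM : 2 ≤ M) {r : ℝ} (hr : 0 < r) (hrM : r * M < 1)
    (h : ∀ᶠ k : ℕ in atTop, a k ≤ r * a (k / M)) :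
    ∃ C : ℝ, ∀ n, ∑ k ∈ Finset.range n, a k ≤ C := by
  obtain ⟨K, hK⟩ := eventually_atTop.mp h
  set B := ∑ k ∈ Finset.range K, a k with hB
  have hstep : ∀ n, ∑ k ∈ Finset.range (M * n), a k ≤
      B + r * M * ∑ k ∈ Finset.range n, a k := by
    intro n
    rw [mul_assoc, ← sum_range_mul_div a (by omega), Finset.mul_sum]
    have : ∀ k ∈ Finset.range (M * n), a k ≤ (if k < K then a k else 0) + r * a (k / M) := by
      intro k _
      split_ifs with hk
      · have := mul_nonneg hr.le (ha0 (k / M)); linarith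
      · simpa using hK k (not_lt.mp hk)
    refine (Finset.sum_le_sum this).trans ?_
    rw [Finset.sum_add_distrib]
    gcongr
    rw [← Finset.sum_filter]
    refine Finset.sum_le_sum_of_subset_of_nonneg ?_ (fun i _ _ => ha0 i)
    intro k hk
    exact Finset.mem_range.mpr (Finset.mem_filter.mp hk).2
  have hmono : ∀ m n, m ≤ n → ∑ k ∈ Finset.range m, a k ≤ ∑ k ∈ Finset.range n, a k :=
    fun m n hmn => Finset.sum_le_sum_of_subset_of_nonneg
      (Finset.range_subset_range.mpr hmn) (fun i _ _ => ha0 i)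
  refine ⟨B / (1 - r * M), fun n => ?_⟩
  rw [le_div_iff₀ (by linarith)]
  have h1 := hmono n (M * n) (Nat.le_mul_of_pos_left _ (by omega))
  have h2 := hstep n
  nlinarith

/-- Along the indices `M ^ j * k₀` the partial sums are at least a multiple of `(r M) ^ j`,
exponential in `j`, whereas the logarithm of the index is linear in `j`. -/
theorem not_isBigO_log_of_expansion (ha0 : ∀ n, 0 < a n) (ha : Antitone a) {M : ℕ}
    (hM : 2 ≤ M) {r : ℝ} (hr : 0 < r) (hrM : 1 < r * M)
    (h : ∀ᶠ k : ℕ in atTop, r * a (k / M) ≤ a k) :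
    ¬ (fun n : ℕ => ∑ k ∈ Finset.range n, a k) =O[atTop] (fun n : ℕ => Real.log (n : ℝ)) := by
  intro hO
  obtain ⟨K, hK⟩ := eventually_atTop.mp h
  set k₀ := K + 1 with hk₀
  have hMpos : 0 < M := by omega
  have h1 : ∀ j : ℕ, r ^ j * a k₀ ≤ a (M ^ j * k₀) := by
    intro j
    induction j with
    | zero => simp
    | succ j ih =>
      have h2 := hK (M ^ (j + 1) * k₀) (by
        have := Nat.le_mul_of_pos_left k₀ (show 0 < M ^ (j + 1) by positivity)
        omega)
      have h3 : M ^ (j + 1) * k₀ / M = M ^ j * k₀ := by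
        rw [pow_succ', mul_assoc, Nat.mul_div_cancel_left _ hMpos]
      rw [h3] at h2
      refine le_trans ?_ h2
      rw [pow_succ', mul_assoc]
      gcongr
  have h2 : ∀ j : ℕ, (r * M) ^ j * (k₀ * a k₀) ≤ ∑ k ∈ Finset.range (M ^ j * k₀), a k := by
    intro j
    have : ∑ k ∈ Finset.range (M ^ j * k₀), a (M ^ j * k₀) ≤
        ∑ k ∈ Finset.range (M ^ j * k₀), a k :=
      Finset.sum_le_sum fun k hk => ha (Finset.mem_range.mp hk).le
    refine le_trans ?_ this
    rw [Finset.sum_const, Finset.card_range, nsmul_eq_mul]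
    push_cast
    rw [mul_pow]
    have h3 := mul_le_mul_of_nonneg_left (h1 j) (show (0 : ℝ) ≤ M ^ j * k₀ by positivity)
    calc _ = (M : ℝ) ^ j * k₀ * (r ^ j * a k₀) := by ring
      _ ≤ _ := by exact_mod_cast h3
  have hlim : Tendsto (fun j : ℕ => M ^ j * k₀) atTop atTop :=
    (tendsto_pow_atTop_atTop_of_one_lt (by omega)).atTop_mul_const' (by omega)
  have hO2 := hO.comp_tendsto hlim
  have hlin : (fun j : ℕ => (Real.log ((M ^ j * k₀ : ℕ) : ℝ))) =O[atTop] (fun j : ℕ => (j : ℝ)) := by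
    refine Asymptotics.IsBigO.of_bound (Real.log M + Real.log k₀) ?_
    filter_upwards [eventually_ge_atTop 1] with j hj
    have hMR : (1 : ℝ) ≤ M := by exact_mod_cast hMpos
    have hkR : (1 : ℝ) ≤ k₀ := by exact_mod_cast (by omega : 1 ≤ k₀)
    have hj' : (1 : ℝ) ≤ j := by exact_mod_cast hj
    have hl1 := Real.log_nonneg hMR
    have hl2 := Real.log_nonneg hkR
    push_cast
    rw [Real.log_mul (by positivity) (by positivity), Real.log_pow, Real.norm_of_nonneg (by positivity),
      Real.norm_of_nonneg (by positivity)]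
    nlinarith
  have hfin := hO2.trans hlin
  have hexp : (fun j : ℕ => (r * M) ^ j * (k₀ * a k₀)) =O[atTop] (fun j : ℕ => (j : ℝ)) := by
    refine Asymptotics.IsBigO.trans (Asymptotics.IsBigO.of_bound 1 ?_) hfin
    refine Eventually.of_forall fun j => ?_
    have hpos : 0 ≤ (r * M) ^ j * (k₀ * a k₀) := by have := ha0 k₀; positivity
    rw [one_mul, Real.norm_of_nonneg hpos, Function.comp,
      Real.norm_of_nonneg (hpos.trans (h2 j))]
    exact h2 j
  have hpos : 0 < k₀ * a k₀ := by have := ha0 k₀; positivity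
  have hlo : (fun j : ℕ => (j : ℝ)) =o[atTop] (fun j : ℕ => (r * M) ^ j * (k₀ * a k₀)) := by
    have h3 := isLittleO_pow_const_const_pow_of_one_lt (R := ℝ) 1 hrM
    simp only [pow_one] at h3
    simp only [mul_comm _ (k₀ * a k₀)]
    exact h3.trans_isBigO (Asymptotics.isBigO_self_const_mul hpos.ne' _ _)
  refine Asymptotics.isLittleO_irrefl ?_ (hexp.trans_isLittleO hlo)
  exact Eventually.frequently (Eventually.of_forall fun j => by positivity)

end PartialSums

/-! ### Logarithmic slopes versus decay of the sequence. -/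

section LogSlopes

variable {H : Type*} [NormedAddCommGroup H] [InnerProductSpace ℂ H] [CompleteSpace H]
  {T : H →L[ℂ] H} {l : ℕ → ℝ}

theorem eventually_slope_bounds {c : ℝ} (hc : 0 < c) (hl : IsLowerC T (ENNReal.ofReal c))
    (hu : IsUpperC T (ENNReal.ofReal c)) {ε : ℝ} (hε : 0 < ε) :
    ∀ᶠ h : ℝ in atTop, ∀ᶠ t : ℝ in atTop,
      c⁻¹ - ε < (logSingularValue T (t + h) - logSingularValue T t) / h ∧
        (logSingularValue T (t + h) - logSingularValue T t) / h < c⁻¹ + ε := by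
  have hc' : 0 < c⁻¹ := inv_pos.mpr hc
  rw [IsLowerC, ← ENNReal.ofReal_inv_of_pos hc] at hl
  rw [IsUpperC, ← ENNReal.ofReal_inv_of_pos hc] at hu
  have h1 : ENNReal.ofReal c⁻¹ < ENNReal.ofReal (c⁻¹ + ε) :=
    (ENNReal.ofReal_lt_ofReal_iff (by positivity)).mpr (by linarith)
  have h2 : ENNReal.ofReal (c⁻¹ - ε) < ENNReal.ofReal c⁻¹ :=
    (ENNReal.ofReal_lt_ofReal_iff hc').mpr (by linarith)
  filter_upwards [hl.eventually (gt_mem_nhds h1), hu.eventually (lt_mem_nhds h2)] with h h3 h4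
  filter_upwards [eventually_lt_of_limsup_lt h3, eventually_lt_of_lt_liminf h4] with t h5 h6
  -- Truncation at `0` loses nothing: a strict inequality between the truncations forces the one
  -- between the real numbers.
  exact ⟨(ENNReal.ofReal_lt_ofReal_iff'.mp h6).1, (ENNReal.ofReal_lt_ofReal_iff'.mp h5).1⟩

/-- The slope estimate is read off at `t = log n` and `h = log N`, where both integer parts are
exact. -/
theorem regularDecay_of_isLowerC_of_isUpperC (hT : ∀ n, 1 ≤ n → singularValue T n = l n)
    (hl0 : ∀ n, 0 < l n) {c : ℝ} (hc : 0 < c) (hlc : IsLowerC T (ENNReal.ofReal c))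
    (huc : IsUpperC T (ENNReal.ofReal c)) : RegularDecay l c⁻¹ := by
  intro ε hε
  have hlog : Tendsto (fun n : ℕ => Real.log n) atTop atTop :=
    Real.tendsto_log_atTop.comp tendsto_natCast_atTop_atTop
  filter_upwards [hlog.eventually (eventually_slope_bounds hc hlc huc hε), eventually_ge_atTop 2]
    with N hN hN2
  filter_upwards [hlog.eventually hN, eventually_ge_atTop 1] with n hn hn1
  have hNR : (2 : ℝ) ≤ N := by exact_mod_cast hN2
  have hNpos : (0 : ℝ) < N := by linarith
  have hnpos : (0 : ℝ) < n := by exact_mod_cast hn1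
  have hlogN : 0 < Real.log N := Real.log_pos (by linarith)
  have e1 : ⌊Real.exp (Real.log n)⌋₊ = n := by rw [Real.exp_log hnpos, Nat.floor_natCast]
  have e2 : ⌊Real.exp (Real.log n + Real.log N)⌋₊ = N * n := by
    rw [← Real.log_mul hnpos.ne' hNpos.ne', Real.exp_log (by positivity), ← Nat.cast_mul,
      Nat.floor_natCast, mul_comm]
  simp only [logSingularValue, e1, e2, hT n hn1,
    hT (N * n) (Nat.mul_pos (by omega) hn1)] at hn
  rw [lt_div_iff₀ hlogN, div_lt_iff₀ hlogN] at hn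
  constructor
  · rw [← Real.log_le_log_iff (mul_pos (by positivity) (hl0 _)) (hl0 _),
      Real.log_mul (by positivity) (hl0 _).ne', Real.log_rpow hNpos]
    linarith [hn.2]
  · rw [← Real.log_le_log_iff (hl0 _) (mul_pos (by positivity) (hl0 _)),
      Real.log_mul (by positivity) (hl0 _).ne', Real.log_rpow hNpos]
    linarith [hn.1]

theorem tendsto_log_sub_of_tendsto_ratio (hl0 : ∀ n, 0 < l n) {L : ℝ} (hL : 1 < L)
    (h : Tendsto (fun n => l n / l (2 * n)) atTop (𝓝 L)) (j : ℕ) :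
    Tendsto (fun n => Real.log (l n) - Real.log (l (2 ^ j * n))) atTop (𝓝 (j * Real.log L)) := by
  have h1 : Tendsto (fun n => Real.log (l n) - Real.log (l (2 * n))) atTop (𝓝 (Real.log L)) := by
    simp only [← Real.log_div (hl0 _).ne' (hl0 _).ne']
    exact h.log (by linarith)
  induction j with
  | zero => simp
  | succ j ih =>
    have h2 : Tendsto (fun n : ℕ => 2 ^ j * n) atTop atTop :=
      tendsto_id.const_mul_atTop' (by positivity)
    have h3 := ih.add (h1.comp h2)
    push_cast
    rw [add_mul, one_mul]
    refine h3.congr fun n => ?_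
    simp only [Function.comp]
    rw [← mul_assoc, ← pow_succ']
    ring

theorem eventually_increment_bounds (hT : ∀ n, 1 ≤ n → singularValue T n = l n)
    (hl : Antitone l) (hl0 : ∀ n, 0 < l n) {L : ℝ} (hL : 1 < L)
    (h : Tendsto (fun n => l n / l (2 * n)) atTop (𝓝 L)) (j : ℕ) {x : ℝ}
    (hx1 : j * Real.log 2 ≤ x) (hx2 : x < (j + 1) * Real.log 2) :
    ∀ᶠ t : ℝ in atTop, j * Real.log L - 1 ≤ logSingularValue T (t + x) - logSingularValue T t ∧
      logSingularValue T (t + x) - logSingularValue T t ≤ (j + 2) * Real.log L + 1 := by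
  have hfl : Tendsto (fun t : ℝ => ⌊Real.exp t⌋₊) atTop atTop :=
    tendsto_nat_floor_atTop.comp Real.tendsto_exp_atTop
  have h1 := (tendsto_log_sub_of_tendsto_ratio hl0 hL h j).eventually
    (lt_mem_nhds (show j * Real.log L - 1 < j * Real.log L by linarith))
  have h2 := (tendsto_log_sub_of_tendsto_ratio hl0 hL h (j + 2)).eventually
    (gt_mem_nhds (show ((j + 2 : ℕ) : ℝ) * Real.log L < ((j + 2 : ℕ) : ℝ) * Real.log L + 1
      by linarith))
  have hx0 : 0 ≤ x := le_trans (mul_nonneg (Nat.cast_nonneg _) (Real.log_nonneg one_le_two)) hx1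
  filter_upwards [hfl.eventually h1, hfl.eventually h2, hfl.eventually (eventually_ge_atTop 1)]
    with t h3 h4 hn1
  have hexp1 : (2 : ℝ) ^ j ≤ Real.exp x := by
    rw [← Real.log_le_iff_le_exp (by positivity), Real.log_pow]; exact hx1
  have hexp2 : Real.exp x < 2 ^ (j + 1) := by
    rw [← Real.lt_log_iff_exp_lt (by positivity), Real.log_pow]; exact_mod_cast hx2
  set n := ⌊Real.exp t⌋₊ with hn
  have hn2 : (n : ℝ) ≤ Real.exp t := Nat.floor_le (Real.exp_pos t).le
  have hn3 : Real.exp t < n + 1 := Nat.lt_floor_add_one _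
  have hm1 : 2 ^ j * n ≤ ⌊Real.exp (t + x)⌋₊ := by
    apply Nat.le_floor
    rw [Real.exp_add]
    push_cast
    rw [mul_comm]
    gcongr
  -- The extra doubling beyond `j + 1` absorbs the rounding `e ^ t < n + 1 ≤ 2 n`.
  have hm2 : ⌊Real.exp (t + x)⌋₊ ≤ 2 ^ (j + 2) * n := by
    apply Nat.floor_le_of_le
    rw [Real.exp_add]
    have hn1' : (1 : ℝ) ≤ n := by exact_mod_cast hn1
    calc Real.exp t * Real.exp x ≤ (2 * n) * 2 ^ (j + 1) := by
          gcongr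
          linarith
      _ = _ := by push_cast; ring
  have hm0 : 1 ≤ ⌊Real.exp (t + x)⌋₊ :=
    le_trans (Nat.mul_pos (by positivity) hn1) hm1
  simp only [logSingularValue, ← hn, hT n hn1, hT _ hm0]
  have h5 := Real.log_le_log (hl0 _) (hl hm1)
  have h6 := Real.log_le_log (hl0 _) (hl hm2)
  push_cast at h4
  constructor <;> linarith

theorem isLowerC_and_isUpperC_of_tendsto_ratio (hT : ∀ n, 1 ≤ n → singularValue T n = l n)
    (hl : Antitone l) (hl0 : ∀ n, 0 < l n) {L : ℝ} (hL : 1 < L)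
    (h : Tendsto (fun n => l n / l (2 * n)) atTop (𝓝 L)) :
    IsLowerC T (ENNReal.ofReal (Real.log 2 / Real.log L)) ∧
      IsUpperC T (ENNReal.ofReal (Real.log 2 / Real.log L)) := by
  have hL0 := Real.log_pos hL
  have h20 := Real.log_pos one_lt_two
  have hbd : ∀ᶠ x : ℝ in atTop, ∀ᶠ t : ℝ in atTop,
      Real.log L / Real.log 2 - (Real.log L + 1) / x ≤
        (logSingularValue T (t + x) - logSingularValue T t) / x ∧
      (logSingularValue T (t + x) - logSingularValue T t) / x ≤
        Real.log L / Real.log 2 + (2 * Real.log L + 1) / x := by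
    filter_upwards [eventually_gt_atTop 0] with x hx
    have hj1 : ⌊x / Real.log 2⌋₊ * Real.log 2 ≤ x :=
      (le_div_iff₀ h20).mp (Nat.floor_le (by positivity))
    have hj2 : x < (⌊x / Real.log 2⌋₊ + 1) * Real.log 2 :=
      (div_lt_iff₀ h20).mp (Nat.lt_floor_add_one _)
    filter_upwards [eventually_increment_bounds hT hl hl0 hL h _ hj1 hj2] with t ht
    set j : ℝ := (⌊x / Real.log 2⌋₊ : ℝ)
    have h3 : x / Real.log 2 < j + 1 := (div_lt_iff₀ h20).mpr hj2
    have h4 : j ≤ x / Real.log 2 := (le_div_iff₀ h20).mpr hj1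
    have e1 : (Real.log L / Real.log 2 - (Real.log L + 1) / x) * x
        = (x / Real.log 2 - 1) * Real.log L - 1 := by field_simp; ring
    have e2 : (Real.log L / Real.log 2 + (2 * Real.log L + 1) / x) * x
        = (x / Real.log 2 + 2) * Real.log L + 1 := by field_simp; ring
    rw [le_div_iff₀ hx, div_le_iff₀ hx, e1, e2]
    constructor <;> nlinarith
  have hlim1 : Tendsto (fun x : ℝ => ENNReal.ofReal
      (Real.log L / Real.log 2 - (Real.log L + 1) / x)) atTop
      (𝓝 (ENNReal.ofReal (Real.log 2 / Real.log L))⁻¹) := by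
    rw [← ENNReal.ofReal_inv_of_pos (by positivity), inv_div]
    apply (ENNReal.continuous_ofReal.tendsto _).comp
    have h1 : Tendsto (fun x : ℝ => (Real.log L + 1) / x) atTop (𝓝 0) :=
      tendsto_const_nhds.div_atTop tendsto_id
    simpa using h1.const_sub (Real.log L / Real.log 2)
  have hlim2 : Tendsto (fun x : ℝ => ENNReal.ofReal
      (Real.log L / Real.log 2 + (2 * Real.log L + 1) / x)) atTop
      (𝓝 (ENNReal.ofReal (Real.log 2 / Real.log L))⁻¹) := by
    rw [← ENNReal.ofReal_inv_of_pos (by positivity), inv_div]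
    apply (ENNReal.continuous_ofReal.tendsto _).comp
    have h1 : Tendsto (fun x : ℝ => (2 * Real.log L + 1) / x) atTop (𝓝 0) :=
      tendsto_const_nhds.div_atTop tendsto_id
    simpa using h1.const_add (Real.log L / Real.log 2)
  have hle1 : ∀ᶠ x : ℝ in atTop, ENNReal.ofReal (Real.log L / Real.log 2 - (Real.log L + 1) / x) ≤
      liminf (fun t : ℝ => ENNReal.ofReal
        ((logSingularValue T (t + x) - logSingularValue T t) / x)) atTop := by
    filter_upwards [hbd] with x hx
    exact le_liminf_of_le (by isBoundedDefault) (hx.mono fun t ht => ENNReal.ofReal_le_ofReal ht.1)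
  have hle2 : ∀ᶠ x : ℝ in atTop, limsup (fun t : ℝ => ENNReal.ofReal
        ((logSingularValue T (t + x) - logSingularValue T t) / x)) atTop ≤
      ENNReal.ofReal (Real.log L / Real.log 2 + (2 * Real.log L + 1) / x) := by
    filter_upwards [hbd] with x hx
    exact limsup_le_of_le (by isBoundedDefault) (hx.mono fun t ht => ENNReal.ofReal_le_ofReal ht.2)
  have hle3 : ∀ x : ℝ, liminf (fun t : ℝ => ENNReal.ofReal
        ((logSingularValue T (t + x) - logSingularValue T t) / x)) atTop ≤
      limsup (fun t : ℝ => ENNReal.ofReal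
        ((logSingularValue T (t + x) - logSingularValue T t) / x)) atTop :=
    fun x => liminf_le_limsup
  exact ⟨tendsto_of_tendsto_of_tendsto_of_le_of_le' hlim1 hlim2
      (hle1.mono fun x hx => hx.trans (hle3 x)) hle2,
    tendsto_of_tendsto_of_tendsto_of_le_of_le' hlim1 hlim2 hle1
      (hle2.mono fun x hx => (hle3 x).trans hx)⟩

end LogSlopes

/-! ### Isometries permuting basis vectors into subsets of the basis. -/

section Shift

variable {H : Type*} [NormedAddCommGroup H] [InnerProductSpace ℂ H] [CompleteSpace H]

theorem exists_isometry_of_injective (e : HilbertBasis ℕ ℂ H) {σ : ℕ → ℕ}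
    (hσ : Function.Injective σ) : ∃ V : H →L[ℂ] H, star V * V = 1 ∧ ∀ n, V (e n) = e (σ n) := by
  have hon : Orthonormal ℂ (e ∘ σ) := e.orthonormal.comp σ hσ
  let U : H →ₗᵢ[ℂ] H := hon.orthogonalFamily.linearIsometry.comp e.repr.toLinearIsometry
  refine ⟨U.toContinuousLinearMap, ?_, fun n => ?_⟩
  · rw [ContinuousLinearMap.star_eq_adjoint]
    exact ContinuousLinearMap.norm_map_iff_adjoint_comp_self _ |>.mp U.norm_map
  · change hon.orthogonalFamily.linearIsometry (e.repr (e n)) = _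
    rw [e.repr_self, OrthogonalFamily.linearIsometry_apply_single]
    simp

theorem star_apply_of_isometry {e : HilbertBasis ℕ ℂ H} {σ : ℕ → ℕ} {V : H →L[ℂ] H}
    (hV : star V * V = 1) (hVe : ∀ n, V (e n) = e (σ n)) (n : ℕ) : star V (e (σ n)) = e n := by
  rw [← hVe, ← mul_apply_eq_comp, hV, one_apply_eq_self]

theorem star_apply_of_notMem_range {e : HilbertBasis ℕ ℂ H} {σ : ℕ → ℕ} {V : H →L[ℂ] H}
    (hVe : ∀ n, V (e n) = e (σ n)) {k : ℕ} (hk : ∀ n, σ n ≠ k) : star V (e k) = 0 := by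
  apply e.eq_zero_of_inner_eq_zero
  intro n
  rw [ContinuousLinearMap.star_eq_adjoint, ContinuousLinearMap.adjoint_inner_right, hVe]
  exact e.orthonormal.2 (hk n)

end Shift

theorem real_smul_nonneg {H : Type*} [NormedAddCommGroup H] [InnerProductSpace ℂ H]
    [CompleteSpace H] {r : ℝ} (hr : 0 ≤ r) {A : H →L[ℂ] H} (hA : 0 ≤ A) : 0 ≤ (r : ℂ) • A := by
  rw [ContinuousLinearMap.nonneg_iff_isPositive] at hA ⊢
  exact hA.smul_of_nonneg (Complex.zero_le_real.mpr hr)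

/-! ### Singular traces on diagonal operators. -/

namespace SingularTrace

variable {H : Type*} [NormedAddCommGroup H] [InnerProductSpace ℂ H] [CompleteSpace H]
  (τ : SingularTrace H)

theorem mono {A B : H →L[ℂ] H} (hA : 0 ≤ A) (hAB : A ≤ B) : τ.toFun A ≤ τ.toFun B := by
  have h := τ.map_add A (B - A) hA (sub_nonneg.mpr hAB)
  rw [add_sub_cancel] at h
  rw [h]
  exact le_self_add

theorem map_zero : τ.toFun 0 = 0 := by
  have h := τ.map_smul 0 0 le_rfl
  simpa using h

theorem map_real_smul {r : ℝ} (hr : 0 ≤ r) {A : H →L[ℂ] H} (hA : 0 ≤ A) :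
    τ.toFun ((r : ℂ) • A) = ENNReal.ofReal r * τ.toFun A :=
  τ.map_smul ⟨r, hr⟩ A hA |>.trans (by rw [ENNReal.ofReal_eq_coe_nnreal hr]; rfl)

theorem map_sum {ι : Type*} (s : Finset ι) (A : ι → H →L[ℂ] H) (hA : ∀ i, 0 ≤ A i) :
    τ.toFun (∑ i ∈ s, A i) = ∑ i ∈ s, τ.toFun (A i) := by
  classical
  induction s using Finset.induction_on with
  | empty => simp [τ.map_zero]
  | insert i s hi ih =>
    rw [Finset.sum_insert hi, Finset.sum_insert hi,
      τ.map_add _ _ (hA i) (Finset.sum_nonneg fun j _ => hA j), ih]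

/-- The trace property applied to `X = √T V*`: here `X* X = V T V*`, and `X X* = T` since `V* V =
1`. -/
theorem map_conj_isometry {V T : H →L[ℂ] H} (hV : star V * V = 1) (hT : 0 ≤ T) :
    τ.toFun (V * T * star V) = τ.toFun T := by
  have hs : star (CFC.sqrt T) = CFC.sqrt T := (CFC.sqrt_nonneg T).isSelfAdjoint
  have hss := CFC.sqrt_mul_sqrt_self T hT
  have h := τ.tracial (CFC.sqrt T * star V)
  have e1 : star (CFC.sqrt T * star V) * (CFC.sqrt T * star V) = V * T * star V := by
    rw [star_mul, star_star, hs]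
    calc _ = V * (CFC.sqrt T * CFC.sqrt T) * star V := by simp only [mul_assoc]
      _ = _ := by rw [hss]
  have e2 : (CFC.sqrt T * star V) * star (CFC.sqrt T * star V) = T := by
    rw [star_mul, star_star, hs]
    calc _ = CFC.sqrt T * (star V * V) * CFC.sqrt T := by simp only [mul_assoc]
      _ = T := by rw [hV, mul_one, hss]
  rwa [e1, e2] at h

variable {e : HilbertBasis ℕ ℂ H} {T : H →L[ℂ] H} {a : ℕ → ℝ}

/-- The finitely many exceptional eigenvalues are moved into a combination of rank one projections,
on which the trace vanishes. -/
theorem le_of_eventually_le {T' : H →L[ℂ] H} {a' : ℕ → ℝ}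
    (hT : ∀ i, T (e i) = (a i : ℂ) • e i) (hT' : ∀ i, T' (e i) = (a' i : ℂ) • e i)
    (ha : ∀ i, 0 ≤ a i) (ha' : ∀ i, 0 ≤ a' i) (h : ∀ᶠ k in atTop, a k ≤ a' k) :
    τ.toFun T ≤ τ.toFun T' := by
  obtain ⟨K, hK⟩ := eventually_atTop.mp h
  let P : ℕ → H →L[ℂ] H := fun i => InnerProductSpace.rankOne ℂ (e i) (e i)
  have hP : ∀ i, IsStarProjection (P i) := fun i =>
    InnerProductSpace.isStarProjection_rankOne_self (e.orthonormal.1 i)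
  have hP0 : ∀ i, 0 ≤ P i := fun i => (hP i).nonneg
  have hPτ : ∀ i, τ.toFun (P i) = 0 := by
    intro i
    refine τ.map_projection _ (hP i) ?_
    have hle : LinearMap.range (P i : H →ₗ[ℂ] H) ≤ Submodule.span ℂ {e i} := by
      rintro _ ⟨x, rfl⟩
      exact Submodule.smul_mem _ _ (Submodule.mem_span_singleton_self _)
    exact Submodule.finiteDimensional_of_le hle
  have hPe : ∀ i k, P i (e k) = if i = k then e k else 0 := by
    intro i k
    simp only [P, InnerProductSpace.rankOne_apply, orthonormal_iff_ite.mp e.orthonormal]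
    split_ifs with h <;> simp [h]
  let F : H →L[ℂ] H := ∑ i ∈ Finset.range K, (a i : ℂ) • P i
  have hsm : ∀ i, 0 ≤ (a i : ℂ) • P i := fun i =>
    real_smul_nonneg (ha i) (hP0 i)
  have hF0 : 0 ≤ F := Finset.sum_nonneg fun i _ => hsm i
  have hFτ : τ.toFun F = 0 := by
    rw [τ.map_sum _ _ hsm]
    exact Finset.sum_eq_zero fun i _ => by rw [τ.map_real_smul (ha i) (hP0 i), hPτ, mul_zero]
  have hFe : ∀ k, F (e k) = ((if k < K then a k else 0 : ℝ) : ℂ) • e k := by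
    intro k
    simp only [F, sum_apply, smul_apply, hPe]
    simp [smul_ite, ite_smul]
  have hle : T ≤ T' + F := by
    rw [← sub_nonneg]
    refine nonneg_of_diagonal (e := e)
      (a := fun k => a' k + (if k < K then a k else 0) - a k) (fun k => ?_) fun k => ?_
    · rw [sub_apply, add_apply, hT, hT', hFe, ← add_smul, ← sub_smul]
      norm_cast
    · split_ifs with hk
      · simpa using ha' k
      · simpa using hK k (not_lt.mp hk)
  calc τ.toFun T ≤ τ.toFun (T' + F) := τ.mono (nonneg_of_diagonal hT ha) hle
    _ = τ.toFun T' := by rw [τ.map_add _ _ (nonneg_of_diagonal hT' ha') hF0, hFτ, add_zero]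

/-- The isometries `e n ↦ e (M n + j)`, for `j < M`, have orthogonal ranges that exhaust the basis.
Summing the `M` conjugates of `T` repeats each eigenvalue `M` times, and each conjugate has the
trace of `T`. -/
theorem exists_dilation (hT : ∀ i, T (e i) = (a i : ℂ) • e i) (ha : ∀ i, 0 ≤ a i)
    {M : ℕ} (hM : 0 < M) {r : ℝ} (hr : 0 ≤ r) : ∃ S : H →L[ℂ] H,
      (∀ k, S (e k) = ((r * a (k / M) : ℝ) : ℂ) • e k) ∧
      ∀ τ : SingularTrace H, τ.toFun S = ENNReal.ofReal (r * M) * τ.toFun T := by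
  have hT0 := nonneg_of_diagonal hT ha
  choose V hV hVe using fun j : ℕ => exists_isometry_of_injective e
    (σ := fun n => M * n + j) (fun m n h => by
      have h : M * m + j = M * n + j := h
      exact Nat.eq_of_mul_eq_mul_left hM (by omega))
  have hV0 : ∀ j, 0 ≤ V j * T * star (V j) := fun j => star_right_conjugate_nonneg hT0 _
  have hVT : ∀ j k, j < M → (V j * T * star (V j)) (e k) =
      if k % M = j then (a (k / M) : ℂ) • e k else 0 := by
    intro j k hj
    rw [mul_apply_eq_comp, mul_apply_eq_comp]
    split_ifs with h
    · have hk : e k = e (M * (k / M) + j) := by rw [← h, Nat.div_add_mod]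
      have h1 : star (V j) (e k) = e (k / M) := by
        rw [hk]; exact star_apply_of_isometry (hV j) (hVe j) _
      rw [h1, hT, ContinuousLinearMap.map_smul, hVe, ← hk]
    · have h1 : star (V j) (e k) = 0 := by
        refine star_apply_of_notMem_range (hVe j) fun n hn => h ?_
        have hn : M * n + j = k := hn
        rw [← hn, Nat.mul_add_mod, Nat.mod_eq_of_lt hj]
      rw [h1, ContinuousLinearMap.map_zero, ContinuousLinearMap.map_zero]
  refine ⟨(r : ℂ) • ∑ j ∈ Finset.range M, V j * T * star (V j), fun k => ?_, fun τ => ?_⟩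
  · rw [smul_apply, sum_apply,
      Finset.sum_congr rfl fun j hj => hVT j k (Finset.mem_range.mp hj)]
    rw [Finset.sum_ite_eq, if_pos (Finset.mem_range.mpr (Nat.mod_lt _ hM)), smul_smul]
    norm_cast
  · rw [τ.map_real_smul hr (Finset.sum_nonneg fun j _ => hV0 j), τ.map_sum _ _ hV0,
      Finset.sum_congr rfl fun j _ => τ.map_conj_isometry (hV j) hT0]
    rw [Finset.sum_const, Finset.card_range, nsmul_eq_mul, ENNReal.ofReal_mul hr,
      ENNReal.ofReal_natCast, mul_assoc]

theorem toFun_ne_one_of_contraction (hT : ∀ i, T (e i) = (a i : ℂ) • e i) (ha : ∀ i, 0 ≤ a i)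
    {M : ℕ} (hM : 0 < M) {r : ℝ} (hr : 0 ≤ r) (hrM : r * M < 1)
    (h : ∀ᶠ k in atTop, a k ≤ r * a (k / M)) : τ.toFun T ≠ 1 := by
  intro h1
  obtain ⟨S, hS, hτ⟩ := exists_dilation hT ha hM hr
  have := τ.le_of_eventually_le hT hS ha (fun i => mul_nonneg hr (ha _)) h
  rw [hτ, h1, mul_one, ENNReal.one_le_ofReal] at this
  linarith

theorem toFun_ne_one_of_expansion (hT : ∀ i, T (e i) = (a i : ℂ) • e i) (ha : ∀ i, 0 ≤ a i)
    {M : ℕ} (hM : 0 < M) {r : ℝ} (hr : 0 ≤ r) (hrM : 1 < r * M)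
    (h : ∀ᶠ k in atTop, r * a (k / M) ≤ a k) : τ.toFun T ≠ 1 := by
  intro h1
  obtain ⟨S, hS, hτ⟩ := exists_dilation hT ha hM hr
  have := τ.le_of_eventually_le hS hT (fun i => mul_nonneg hr (ha _)) ha h
  rw [hτ, h1, mul_one, ENNReal.ofReal_le_one] at this
  linarith

end SingularTrace

/-! ### Partial traces over orthonormal families. -/

section QuadraticSums

variable {H : Type*} [NormedAddCommGroup H] [InnerProductSpace ℂ H]

/-- Replacing `y` by its projection onto the larger span changes no inner product; then Parseval
holds for `w` and Bessel for `v`. -/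
theorem sum_norm_inner_sq_le_of_span_le {ι κ : Type*} [Fintype ι] [Fintype κ] {v : ι → H}
    {w : κ → H} (hv : Orthonormal ℂ v) (hw : Orthonormal ℂ w)
    (h : Submodule.span ℂ (Set.range v) ≤ Submodule.span ℂ (Set.range w)) (y : H) :
    ∑ i, ‖inner ℂ (v i) y‖ ^ 2 ≤ ∑ j, ‖inner ℂ (w j) y‖ ^ 2 := by
  set z := ∑ j, inner ℂ (w j) y • w j with hz
  have h1 : ∀ x ∈ Submodule.span ℂ (Set.range w), inner ℂ x y = inner ℂ x z := by
    intro x hx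
    induction hx using Submodule.span_induction with
    | mem x hx =>
      obtain ⟨j, rfl⟩ := hx
      rw [hz, hw.inner_right_fintype]
    | zero => simp
    | add x x' _ _ h h' => rw [inner_add_left, inner_add_left, h, h']
    | smul c x _ h => rw [inner_smul_left, inner_smul_left, h]
  have h2 : ‖z‖ ^ 2 = ∑ j, ‖inner ℂ (w j) y‖ ^ 2 := by
    have h3 : inner ℂ z z = ((∑ j, ‖inner ℂ (w j) y‖ ^ 2 : ℝ) : ℂ) := by
      rw [hz, hw.inner_sum]
      push_cast
      exact Finset.sum_congr rfl fun j _ => RCLike.conj_mul _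
    rw [inner_self_eq_norm_sq_to_K] at h3
    apply Complex.ofReal_injective
    rw [← h3]; simp
  rw [← h2, Finset.sum_congr rfl fun i _ => by
    rw [h1 (v i) (h (Submodule.subset_span ⟨i, rfl⟩))]]
  exact hv.sum_inner_products_le z

variable [CompleteSpace H]

/-- The sum of the values of the quadratic form of `A` at the members of a finite family. -/
noncomputable def quadraticSum {ι : Type*} [Fintype ι] (A : H →L[ℂ] H) (v : ι → H) : ℝ :=
  ∑ i, (inner ℂ (v i) (A (v i))).re

theorem re_inner_star_mul_self (X : H →L[ℂ] H) (x : H) :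
    (inner ℂ x ((star X * X) x)).re = ‖X x‖ ^ 2 := by
  rw [mul_apply_eq_comp, ContinuousLinearMap.star_eq_adjoint,
    ContinuousLinearMap.adjoint_inner_right]
  exact inner_self_eq_norm_sq (𝕜 := ℂ) (X x)

theorem quadraticSum_star_mul_self {ι κ : Type*} [Fintype ι] [Fintype κ] (X : H →L[ℂ] H)
    (v : ι → H) {g : κ → H} (hg : Orthonormal ℂ g)
    (h : ∀ i, X (v i) ∈ Submodule.span ℂ (Set.range g)) :
    quadraticSum (star X * X) v = ∑ k, ∑ i, ‖inner ℂ (v i) (star X (g k))‖ ^ 2 := by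
  rw [Finset.sum_comm, quadraticSum]
  refine Finset.sum_congr rfl fun i _ => ?_
  rw [re_inner_star_mul_self]
  obtain ⟨c, hc⟩ := (Submodule.mem_span_range_iff_exists_fun ℂ).mp (h i)
  have h1 : ∀ k, inner ℂ (v i) (star X (g k)) = (starRingEnd ℂ) (c k) := by
    intro k
    rw [ContinuousLinearMap.star_eq_adjoint, ContinuousLinearMap.adjoint_inner_right, ← hc,
      hg.inner_left_fintype]
  simp only [h1, RCLike.norm_conj]
  rw [← hc]
  have h3 : inner ℂ (∑ k, c k • g k) (∑ k, c k • g k) = ((∑ k, ‖c k‖ ^ 2 : ℝ) : ℂ) := by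
    rw [hg.inner_sum]
    push_cast
    exact Finset.sum_congr rfl fun j _ => RCLike.conj_mul _
  rw [inner_self_eq_norm_sq_to_K] at h3
  apply Complex.ofReal_injective
  rw [← h3]; simp

omit [CompleteSpace H] in
theorem coe_stdOrthonormalBasis_orthonormal (V : Submodule ℂ H) [FiniteDimensional ℂ V] :
    Orthonormal ℂ (fun i => (stdOrthonormalBasis ℂ V i : H)) :=
  (stdOrthonormalBasis ℂ V).orthonormal.comp_linearIsometry V.subtypeₗᵢ

omit [CompleteSpace H] in
theorem span_coe_stdOrthonormalBasis (V : Submodule ℂ H) [FiniteDimensional ℂ V] :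
    Submodule.span ℂ (Set.range fun i => (stdOrthonormalBasis ℂ V i : H)) = V := by
  have h := (stdOrthonormalBasis ℂ V).toBasis.span_eq
  have h2 := congrArg (Submodule.map V.subtype) h
  rw [Submodule.map_span, ← Set.range_comp, Submodule.map_top, Submodule.range_subtype] at h2
  convert h2 using 3
  ext i
  simp

/-- Factor `A = X* X` and expand each `X (v i)` in an orthonormal basis of the image of the larger
span. This reduces the claim to the preceding comparison, applied to one basis vector at a time. -/
theorem quadraticSum_le_of_span_le {ι κ : Type*} [Fintype ι] [Fintype κ] {A : H →L[ℂ] H}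
    (hA : 0 ≤ A) {v : ι → H} {w : κ → H} (hv : Orthonormal ℂ v) (hw : Orthonormal ℂ w)
    (h : Submodule.span ℂ (Set.range v) ≤ Submodule.span ℂ (Set.range w)) :
    quadraticSum A v ≤ quadraticSum A w := by
  obtain ⟨X, rfl⟩ := CStarAlgebra.nonneg_iff_eq_star_mul_self.mp hA
  let G : Submodule ℂ H := (Submodule.span ℂ (Set.range w)).map (X : H →ₗ[ℂ] H)
  have : FiniteDimensional ℂ (Submodule.span ℂ (Set.range w)) :=
    FiniteDimensional.span_of_finite ℂ (Set.finite_range w)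
  have hG : FiniteDimensional ℂ G := inferInstance
  have hspan := span_coe_stdOrthonormalBasis G
  have hmem : ∀ x ∈ Submodule.span ℂ (Set.range w), X x ∈
      Submodule.span ℂ (Set.range fun i => (stdOrthonormalBasis ℂ G i : H)) := by
    intro x hx
    rw [hspan]
    exact ⟨x, hx, rfl⟩
  rw [quadraticSum_star_mul_self X v (coe_stdOrthonormalBasis_orthonormal G)
      (fun i => hmem _ (h (Submodule.subset_span ⟨i, rfl⟩))),
    quadraticSum_star_mul_self X w (coe_stdOrthonormalBasis_orthonormal G)
      (fun i => hmem _ (Submodule.subset_span ⟨i, rfl⟩))]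
  exact Finset.sum_le_sum fun k _ => sum_norm_inner_sq_le_of_span_le hv hw h _

/-- Take for `g` an orthonormal basis of the image under `X` of the span of `v`: the sum becomes `∑
|⟨v i, X* g k⟩|²`, and Bessel in `i` bounds it by `∑ ‖X* g k‖²`. -/
theorem exists_quadraticSum_star_mul_self_le {ι : Type*} [Fintype ι] (X : H →L[ℂ] H) {v : ι → H}
    (hv : Orthonormal ℂ v) : ∃ n ≤ Fintype.card ι, ∃ g : Fin n → H, Orthonormal ℂ g ∧
      quadraticSum (star X * X) v ≤ quadraticSum (X * star X) g := by
  let E : Submodule ℂ H := Submodule.span ℂ (Set.range v)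
  have hE : FiniteDimensional ℂ E := FiniteDimensional.span_of_finite ℂ (Set.finite_range v)
  let G : Submodule ℂ H := E.map (X : H →ₗ[ℂ] H)
  have hG : FiniteDimensional ℂ G := inferInstanceAs (FiniteDimensional ℂ (E.map _))
  have hcard : Module.finrank ℂ G ≤ Fintype.card ι :=
    (Submodule.finrank_map_le _ _).trans (finrank_range_le_card v)
  refine ⟨_, hcard, _, coe_stdOrthonormalBasis_orthonormal G, ?_⟩
  rw [quadraticSum_star_mul_self X v (coe_stdOrthonormalBasis_orthonormal G) (fun i => by
    rw [span_coe_stdOrthonormalBasis]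
    exact ⟨v i, Submodule.subset_span ⟨i, rfl⟩, rfl⟩)]
  refine Finset.sum_le_sum fun k _ => ?_
  have h := re_inner_star_mul_self (star X) (stdOrthonormalBasis ℂ G k : H)
  rw [star_star] at h
  rw [h]
  exact hv.sum_inner_products_le _

omit [CompleteSpace H] in
theorem quadraticSum_add {ι : Type*} [Fintype ι] (A B : H →L[ℂ] H) (v : ι → H) :
    quadraticSum (A + B) v = quadraticSum A v + quadraticSum B v := by
  simp [quadraticSum, Finset.sum_add_distrib]

omit [CompleteSpace H] in
theorem quadraticSum_smul {ι : Type*} [Fintype ι] (r : ℝ) (A : H →L[ℂ] H) (v : ι → H) :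
    quadraticSum ((r : ℂ) • A) v = r * quadraticSum A v := by
  simp [quadraticSum, Finset.mul_sum, -Complex.coe_smul]

omit [CompleteSpace H] in
theorem quadraticSum_sum_elim {ι κ : Type*} [Fintype ι] [Fintype κ] (A : H →L[ℂ] H) (v : ι → H)
    (w : κ → H) : quadraticSum A (Sum.elim v w) = quadraticSum A v + quadraticSum A w := by
  simp [quadraticSum]

omit [CompleteSpace H] in
theorem quadraticSum_nonneg {ι : Type*} [Fintype ι] {A : H →L[ℂ] H} (hA : 0 ≤ A) (v : ι → H) :
    0 ≤ quadraticSum A v :=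
  Finset.sum_nonneg fun i _ =>
    ((ContinuousLinearMap.nonneg_iff_isPositive A).mp hA).re_inner_nonneg_right (v i)

omit [CompleteSpace H] in
theorem quadraticSum_le_card_mul {ι : Type*} [Fintype ι] {A : H →L[ℂ] H} {v : ι → H}
    (hv : Orthonormal ℂ v) {C : ℝ} (h : ∀ i, (inner ℂ (v i) (A (v i))).re ≤ C * ‖v i‖ ^ 2) :
    quadraticSum A v ≤ Fintype.card ι * C := by
  rw [quadraticSum, ← nsmul_eq_mul, Fintype.card, ← Finset.sum_const]
  refine Finset.sum_le_sum fun i _ => ?_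
  simpa [hv.1 i] using h i

omit [CompleteSpace H] in
theorem orthonormal_sum_elim {ι κ : Type*} {v : ι → H} {w : κ → H} (hv : Orthonormal ℂ v)
    (hw : Orthonormal ℂ w) (h : ∀ i j, inner ℂ (v i) (w j) = 0) :
    Orthonormal ℂ (Sum.elim v w) := by
  refine ⟨?_, ?_⟩
  · rintro (i | j)
    exacts [hv.1 i, hw.1 j]
  · rintro (i | i) (j | j) hij
    · exact hv.2 (fun h => hij (congrArg _ h))
    · exact h i j
    · exact inner_eq_zero_symm.mp (h j i)
    · exact hw.2 (fun h => hij (congrArg _ h))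

end QuadraticSums

/-! ### Ky Fan sums. -/

section KyFan

variable {H : Type*} [NormedAddCommGroup H] [InnerProductSpace ℂ H]

/-- The largest sum of values of the quadratic form of `A` at orthonormal families with at most `m`
members; for a positive compact operator, the sum of its `m` largest eigenvalues. -/
noncomputable def kyFanSum [CompleteSpace H] (A : H →L[ℂ] H) (m : ℕ) : ℝ :=
  sSup {x | ∃ n ≤ m, ∃ v : Fin n → H, Orthonormal ℂ v ∧ quadraticSum A v = x}

variable [CompleteSpace H]

omit [CompleteSpace H] in
theorem re_inner_le_norm_mul (A : H →L[ℂ] H) (x : H) :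
    (inner ℂ x (A x)).re ≤ ‖A‖ * ‖x‖ ^ 2 := by
  refine (Complex.re_le_norm _).trans ((norm_inner_le_norm x (A x)).trans ?_)
  nlinarith [A.le_opNorm x, norm_nonneg x]

theorem kyFanSum_le {A : H →L[ℂ] H} {m : ℕ} {C : ℝ}
    (h : ∀ n ≤ m, ∀ v : Fin n → H, Orthonormal ℂ v → quadraticSum A v ≤ C) : kyFanSum A m ≤ C := by
  refine csSup_le ⟨0, 0, Nat.zero_le _, Fin.elim0, ⟨fun i => i.elim0, fun i => i.elim0⟩, ?_⟩ ?_
  · simp [quadraticSum]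
  · rintro x ⟨n, hn, v, hv, rfl⟩
    exact h n hn v hv

theorem le_kyFanSum {ι : Type*} [Fintype ι] (A : H →L[ℂ] H) {m : ℕ} {v : ι → H}
    (hv : Orthonormal ℂ v) (hm : Fintype.card ι ≤ m) : quadraticSum A v ≤ kyFanSum A m := by
  refine le_csSup ⟨m * ‖A‖, ?_⟩ ⟨Fintype.card ι, hm, v ∘ (Fintype.equivFin ι).symm,
    hv.comp _ (Fintype.equivFin ι).symm.injective, ?_⟩
  · rintro x ⟨n, hn, v, hv, rfl⟩
    refine (quadraticSum_le_card_mul hv fun i => re_inner_le_norm_mul A (v i)).trans ?_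
    rw [Fintype.card_fin]
    gcongr
  · exact (Fintype.equivFin ι).symm.sum_comp fun i => (inner ℂ (v i) (A (v i))).re

theorem kyFanSum_nonneg (A : H →L[ℂ] H) (m : ℕ) : 0 ≤ kyFanSum A m := by
  have h := le_kyFanSum (ι := Fin 0) (m := m) A (v := Fin.elim0)
    ⟨fun i => i.elim0, fun i => i.elim0⟩ (by simp)
  simpa [quadraticSum] using h

theorem kyFanSum_mono_right (A : H →L[ℂ] H) : Monotone (kyFanSum A) := fun _ _ hmn =>
  kyFanSum_le fun _ hn _ hv => le_kyFanSum A hv (by simpa using hn.trans hmn)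

theorem quadraticSum_mono {ι : Type*} [Fintype ι] {A B : H →L[ℂ] H} (hAB : A ≤ B) (v : ι → H) :
    quadraticSum A v ≤ quadraticSum B v := by
  have h := quadraticSum_add A (B - A) v
  rw [add_sub_cancel] at h
  rw [h]
  exact le_add_of_nonneg_right (quadraticSum_nonneg (sub_nonneg.mpr hAB) v)

theorem kyFanSum_mono {A B : H →L[ℂ] H} (hAB : A ≤ B) (m : ℕ) : kyFanSum A m ≤ kyFanSum B m :=
  kyFanSum_le fun _ hn v hv => (quadraticSum_mono hAB v).trans (le_kyFanSum B hv (by simpa using hn))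

theorem kyFanSum_add_le (A B : H →L[ℂ] H) (m : ℕ) :
    kyFanSum (A + B) m ≤ kyFanSum A m + kyFanSum B m :=
  kyFanSum_le fun n hn v hv => by
    rw [quadraticSum_add]
    exact add_le_add (le_kyFanSum A hv (by simpa using hn)) (le_kyFanSum B hv (by simpa using hn))

/-- Competing families for `A` and for `B` span together at most `2 m` dimensions, and positivity
lets both partial traces grow to that common span. -/
theorem add_le_kyFanSum {A B : H →L[ℂ] H} (hA : 0 ≤ A) (hB : 0 ≤ B) (m : ℕ) :
    kyFanSum A m + kyFanSum B m ≤ kyFanSum (A + B) (2 * m) := by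
  rw [← le_sub_iff_add_le]
  refine kyFanSum_le fun n hn v hv => ?_
  rw [le_sub_comm]
  refine kyFanSum_le fun n' hn' v' hv' => ?_
  rw [le_sub_iff_add_le, add_comm]
  let E := Submodule.span ℂ (Set.range v)
  let E' := Submodule.span ℂ (Set.range v')
  have hE : FiniteDimensional ℂ E := FiniteDimensional.span_of_finite ℂ (Set.finite_range v)
  have hE' : FiniteDimensional ℂ E' := FiniteDimensional.span_of_finite ℂ (Set.finite_range v')
  let W := E ⊔ E'
  have hcard : Module.finrank ℂ W ≤ 2 * m := by
    have h1 := Submodule.finrank_add_le_finrank_add_finrank E E'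
    have h2 : Module.finrank ℂ E ≤ n := (finrank_range_le_card (R := ℂ) v).trans (by simp)
    have h3 : Module.finrank ℂ E' ≤ n' := (finrank_range_le_card (R := ℂ) v').trans (by simp)
    change Module.finrank ℂ (E ⊔ E' : Submodule ℂ H) ≤ _
    omega
  have hw := coe_stdOrthonormalBasis_orthonormal W
  have hs := span_coe_stdOrthonormalBasis W
  have h1 := quadraticSum_le_of_span_le hA hv hw (hs.symm ▸ le_sup_left)
  have h2 := quadraticSum_le_of_span_le hB hv' hw (hs.symm ▸ le_sup_right)
  have h3 := le_kyFanSum (A + B) hw (by simpa using hcard)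
  rw [quadraticSum_add] at h3
  linarith

theorem kyFanSum_smul {r : ℝ} (hr : 0 ≤ r) (A : H →L[ℂ] H) (m : ℕ) :
    kyFanSum ((r : ℂ) • A) m = r * kyFanSum A m := by
  have hle : ∀ r : ℝ, 0 ≤ r → ∀ A : H →L[ℂ] H, kyFanSum ((r : ℂ) • A) m ≤ r * kyFanSum A m := by
    intro r hr A
    refine kyFanSum_le fun n hn v hv => ?_
    rw [quadraticSum_smul]
    exact mul_le_mul_of_nonneg_left (le_kyFanSum A hv (by simpa using hn)) hr
  refine le_antisymm (hle r hr A) ?_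
  rcases hr.eq_or_lt with rfl | hr
  · simpa using kyFanSum_nonneg _ m
  · have h := hle r⁻¹ (by positivity) ((r : ℂ) • A)
    rw [smul_smul, ← Complex.ofReal_mul, inv_mul_cancel₀ hr.ne', Complex.ofReal_one, one_smul,
      le_inv_mul_iff₀ hr] at h
    exact h

theorem kyFanSum_star_mul_self (X : H →L[ℂ] H) (m : ℕ) :
    kyFanSum (star X * X) m = kyFanSum (X * star X) m := by
  have hle : ∀ X : H →L[ℂ] H, kyFanSum (star X * X) m ≤ kyFanSum (X * star X) m := by
    intro X
    refine kyFanSum_le fun n hn v hv => ?_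
    obtain ⟨k, hk, g, hg, h⟩ := exists_quadraticSum_star_mul_self_le X hv
    refine h.trans (le_kyFanSum _ hg ?_)
    simp only [Fintype.card_fin] at hk ⊢
    omega
  refine le_antisymm (hle X) ?_
  simpa using hle (star X)

omit [CompleteSpace H] in
theorem finrank_le_of_inf_orthogonal_eq_bot {E V : Submodule ℂ H} [FiniteDimensional ℂ V]
    (h : E ⊓ Vᗮ = ⊥) : Module.finrank ℂ E ≤ Module.finrank ℂ V := by
  refine LinearMap.finrank_le_finrank_of_injective
    (f := (V.orthogonalProjectionOnto : H →ₗ[ℂ] V) ∘ₗ E.subtype) ?_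
  rw [← LinearMap.ker_eq_bot, LinearMap.ker_eq_bot']
  intro x hx
  have h1 : (x : H) ∈ Vᗮ := Submodule.orthogonalProjectionOnto_eq_zero_iff.mp hx
  have h2 : (x : H) ∈ E ⊓ Vᗮ := ⟨x.2, h1⟩
  rw [h] at h2
  exact Subtype.ext h2

/-- The span of the test family splits into its part in `Vᗮ`, where the form is at most `ε`, and an
orthogonal remainder, whose dimension is at most `k` because it projects injectively to `V`. -/
theorem kyFanSum_le_add {A : H →L[ℂ] H} (hA : 0 ≤ A) {V : Submodule ℂ H} [FiniteDimensional ℂ V]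
    {k : ℕ} (hV : Module.finrank ℂ V ≤ k) {ε : ℝ} (hε : 0 ≤ ε)
    (h : ∀ x ∈ Vᗮ, (inner ℂ x (A x)).re ≤ ε * ‖x‖ ^ 2) (n : ℕ) :
    kyFanSum A n ≤ kyFanSum A k + n * ε := by
  refine kyFanSum_le fun n' hn v hv => ?_
  let E := Submodule.span ℂ (Set.range v)
  have hE : FiniteDimensional ℂ E := FiniteDimensional.span_of_finite ℂ (Set.finite_range v)
  have hEn : Module.finrank ℂ E ≤ n' := (finrank_range_le_card (R := ℂ) v).trans (by simp)
  let E₁ := E ⊓ Vᗮ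
  let E₂ := E₁ᗮ ⊓ E
  have hE₁ : FiniteDimensional ℂ E₁ := Submodule.finiteDimensional_inf_left _ _
  have hE₂ : FiniteDimensional ℂ E₂ := Submodule.finiteDimensional_inf_right _ _
  have hsup : E₁ ⊔ E₂ = E := Submodule.sup_orthogonal_inf_of_hasOrthogonalProjection inf_le_left
  have hE₁n : Module.finrank ℂ E₁ ≤ n := (Submodule.finrank_mono inf_le_left).trans (hEn.trans hn)
  have hE₂k : Module.finrank ℂ E₂ ≤ k := by
    refine (finrank_le_of_inf_orthogonal_eq_bot (V := V) ?_).trans hV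
    rw [eq_bot_iff]
    rintro x ⟨⟨hx1, hx2⟩, hx3⟩
    have : inner ℂ x x = (0 : ℂ) := (Submodule.mem_orthogonal _ _).mp hx1 x ⟨hx2, hx3⟩
    exact inner_self_eq_zero.mp this
  set b₁ := fun i => (stdOrthonormalBasis ℂ E₁ i : H)
  set b₂ := fun i => (stdOrthonormalBasis ℂ E₂ i : H)
  have hb₁ := coe_stdOrthonormalBasis_orthonormal E₁
  have hb₂ := coe_stdOrthonormalBasis_orthonormal E₂
  have hb := orthonormal_sum_elim hb₁ hb₂ fun i j =>
    (Submodule.mem_orthogonal _ _).mp (stdOrthonormalBasis ℂ E₂ j).2.1 _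
      (stdOrthonormalBasis ℂ E₁ i).2
  have h1 := quadraticSum_le_of_span_le hA hv hb (by
    rw [Set.Sum.elim_range, Submodule.span_union, span_coe_stdOrthonormalBasis,
      span_coe_stdOrthonormalBasis, hsup])
  rw [quadraticSum_sum_elim] at h1
  have h2 := quadraticSum_le_card_mul hb₁ fun i => h _ (stdOrthonormalBasis ℂ E₁ i).2.2
  rw [Fintype.card_fin] at h2
  have h3 := le_kyFanSum A hb₂ (by simpa using hE₂k)
  have h4 : (Module.finrank ℂ E₁ : ℝ) * ε ≤ n * ε := by gcongr
  linarith

end KyFan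

/-! ### Growth of Ky Fan sums of diagonal operators. -/

section KyFanDiagonal

variable {H : Type*} [NormedAddCommGroup H] [InnerProductSpace ℂ H] [CompleteSpace H]
  {e : HilbertBasis ℕ ℂ H} {T : H →L[ℂ] H} {a : ℕ → ℝ}

omit [CompleteSpace H] in
theorem le_re_inner_of_mem_span (hT : ∀ i, T (e i) = (a i : ℂ) • e i) {N : ℕ} {t : ℝ}
    (ht : ∀ i < N, t ≤ a i) {x : H}
    (hx : x ∈ Submodule.span ℂ (Set.range fun i : Fin N => e i)) :
    t * ‖x‖ ^ 2 ≤ (inner ℂ x (T x)).re := by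
  have hid : ∀ i, (ContinuousLinearMap.id ℂ H) (e i) = (((fun _ => 1 : ℕ → ℝ) i : ℝ) : ℂ) • e i := by
    simp
  have h1 := (hasSum_re_inner_of_diagonal hid x).mul_left t
  have h2 := hasSum_re_inner_of_diagonal hT x
  have h3 : (inner ℂ x ((ContinuousLinearMap.id ℂ H) x)).re = ‖x‖ ^ 2 :=
    inner_self_eq_norm_sq (𝕜 := ℂ) x
  rw [h3] at h1
  refine hasSum_le (fun i => ?_) h1 h2
  rw [one_mul]
  by_cases hi : i < N
  · exact mul_le_mul_of_nonneg_right (ht i hi) (by positivity)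
  · have h4 : inner ℂ (e i) x = 0 := by
      clear h1 h2 h3
      induction hx using Submodule.span_induction with
      | mem x hx =>
        obtain ⟨j, rfl⟩ := hx
        exact e.orthonormal.2 (by have := j.2; omega)
      | zero => simp
      | add x x' _ _ h h' => rw [inner_add_right, h, h', add_zero]
      | smul c x _ h => rw [inner_smul_right, h, mul_zero]
    simp [h4]

omit [CompleteSpace H] in
theorem re_inner_le_of_mem_span_orthogonal (hT : ∀ i, T (e i) = (a i : ℂ) • e i) {N : ℕ} {t : ℝ}
    (ht : ∀ i, N ≤ i → a i ≤ t) {x : H}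
    (hx : x ∈ (Submodule.span ℂ (Set.range fun i : Fin N => e i))ᗮ) :
    (inner ℂ x (T x)).re ≤ t * ‖x‖ ^ 2 := by
  have hid : ∀ i, (ContinuousLinearMap.id ℂ H) (e i) = (((fun _ => 1 : ℕ → ℝ) i : ℝ) : ℂ) • e i := by
    simp
  have h1 := (hasSum_re_inner_of_diagonal hid x).mul_left t
  have h2 := hasSum_re_inner_of_diagonal hT x
  have h3 : (inner ℂ x ((ContinuousLinearMap.id ℂ H) x)).re = ‖x‖ ^ 2 :=
    inner_self_eq_norm_sq (𝕜 := ℂ) x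
  rw [h3] at h1
  refine hasSum_le (fun i => ?_) h2 h1
  rw [one_mul]
  by_cases hi : N ≤ i
  · exact mul_le_mul_of_nonneg_right (ht i hi) (by positivity)
  · have h4 : inner ℂ (e i) x = 0 :=
      (Submodule.mem_orthogonal _ _).mp hx _ (Submodule.subset_span ⟨⟨i, by omega⟩, rfl⟩)
    simp [h4]

omit [CompleteSpace H] in
theorem finrank_span_hilbertBasis (e : HilbertBasis ℕ ℂ H) (N : ℕ) :
    Module.finrank ℂ (Submodule.span ℂ (Set.range fun i : Fin N => e i)) = N := by
  exact (finrank_span_eq_card (e.orthonormal.linearIndependent.comp _ Fin.val_injective)).trans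
    (Fintype.card_fin N)

/-- The span of the first `2 n` basis vectors contains `n` orthonormal vectors orthogonal to any
family of at most `n`, and each adds at least `t`. This supplies the increments for the dyadic
argument without identifying Ky Fan sums with eigenvalue sums. -/
theorem kyFanSum_add_le_of_diagonal (hT : ∀ i, T (e i) = (a i : ℂ) • e i) {n : ℕ} {t : ℝ}
    (ht : ∀ i < 2 * n, t ≤ a i) : kyFanSum T n + n * t ≤ kyFanSum T (2 * n) := by
  rw [← le_sub_iff_add_le]
  refine kyFanSum_le fun k hk v hv => ?_
  rw [le_sub_iff_add_le]
  let V := Submodule.span ℂ (Set.range v)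
  have hV : FiniteDimensional ℂ V := FiniteDimensional.span_of_finite ℂ (Set.finite_range v)
  have hVk : Module.finrank ℂ V ≤ k := (finrank_range_le_card (R := ℂ) v).trans (by simp)
  let U := Submodule.span ℂ (Set.range fun i : Fin (2 * n) => e i)
  have hU : FiniteDimensional ℂ U := FiniteDimensional.span_of_finite ℂ (Set.finite_range _)
  let F := U ⊓ Vᗮ
  have hF : FiniteDimensional ℂ F := Submodule.finiteDimensional_inf_left _ _
  have hFn : n ≤ Module.finrank ℂ F := by
    have h1 : Module.finrank ℂ (Fᗮ ⊓ U : Submodule ℂ H) ≤ Module.finrank ℂ V := by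
      refine finrank_le_of_inf_orthogonal_eq_bot ?_
      rw [eq_bot_iff]
      rintro x ⟨⟨hx1, hx2⟩, hx3⟩
      have : inner ℂ x x = (0 : ℂ) := (Submodule.mem_orthogonal _ _).mp hx1 x ⟨hx2, hx3⟩
      exact inner_self_eq_zero.mp this
    have h2 : F ⊔ Fᗮ ⊓ U = U := Submodule.sup_orthogonal_inf_of_hasOrthogonalProjection inf_le_left
    have hF2 : FiniteDimensional ℂ (Fᗮ ⊓ U : Submodule ℂ H) := Submodule.finiteDimensional_inf_right _ _
    have h3 := Submodule.finrank_add_le_finrank_add_finrank F (Fᗮ ⊓ U)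
    rw [h2, finrank_span_hilbertBasis] at h3
    omega
  let g : Fin n → H := fun i => stdOrthonormalBasis ℂ F (Fin.castLE hFn i)
  have hg : Orthonormal ℂ g :=
    (coe_stdOrthonormalBasis_orthonormal F).comp _ (Fin.castLE_injective hFn)
  have hgF : ∀ i, g i ∈ U ⊓ Vᗮ := fun i => (stdOrthonormalBasis ℂ F (Fin.castLE hFn i)).2
  have hvg := orthonormal_sum_elim hv hg fun i j =>
    (Submodule.mem_orthogonal _ _).mp (hgF j).2 _ (Submodule.subset_span ⟨i, rfl⟩)
  have h1 := le_kyFanSum T (m := 2 * n) hvg (by simp; omega)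
  rw [quadraticSum_sum_elim] at h1
  have h2 : (n : ℝ) * t ≤ quadraticSum T g := by
    rw [quadraticSum]
    have : ∑ i : Fin n, t ≤ ∑ i, (inner ℂ (g i) (T (g i))).re := Finset.sum_le_sum fun i _ => by
      simpa [hg.1 i] using le_re_inner_of_mem_span hT ht (hgF i).1
    simpa using this
  linarith

end KyFanDiagonal

/-! ### The ideal of operators dominated by a sequence. -/

section Dominated

variable {H : Type*} [NormedAddCommGroup H] [InnerProductSpace ℂ H] [CompleteSpace H]

/-- Up to a constant, the quadratic form of `A` is at most `a n` on a subspace of codimension at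
most `n`. For a positive compact operator this says that the sequence of its eigenvalues is
dominated by a multiple of `a`. -/
def IsDominatedBy (a : ℕ → ℝ) (A : H →L[ℂ] H) : Prop :=
  ∃ C : ℝ, 0 ≤ C ∧ ∀ n, ∃ V : Submodule ℂ H, FiniteDimensional ℂ V ∧ Module.finrank ℂ V ≤ n ∧
    ∀ x ∈ Vᗮ, (inner ℂ x (A x)).re ≤ C * a n * ‖x‖ ^ 2

namespace IsDominatedBy

variable {a : ℕ → ℝ} {A B : H →L[ℂ] H}

theorem mono (hB : IsDominatedBy a B) (hAB : A ≤ B) : IsDominatedBy a A := by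
  obtain ⟨C, hC, h⟩ := hB
  refine ⟨C, hC, fun n => ?_⟩
  obtain ⟨V, hV, hVn, hx⟩ := h n
  refine ⟨V, hV, hVn, fun x hxV => le_trans ?_ (hx x hxV)⟩
  have h1 := ((ContinuousLinearMap.nonneg_iff_isPositive _).mp
    (sub_nonneg.mpr hAB)).re_inner_nonneg_right x
  rw [sub_apply, inner_sub_right, map_sub, sub_nonneg] at h1
  exact h1

omit [CompleteSpace H] in
theorem add (hA : IsDominatedBy a A) (hB : IsDominatedBy a B) {D : ℝ} (hD0 : 0 ≤ D)
    (hD : ∀ m, a (m / 2) ≤ D * a m) : IsDominatedBy a (A + B) := by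
  obtain ⟨C, hC, h⟩ := hA
  obtain ⟨C', hC', h'⟩ := hB
  refine ⟨(C + C') * D, by positivity, fun n => ?_⟩
  -- Each summand uses half of the allowed codimension; the doubling bound on `a` pays for it.
  obtain ⟨V, hV, hVn, hx⟩ := h (n / 2)
  obtain ⟨V', hV', hVn', hx'⟩ := h' (n / 2)
  have hfin := Submodule.finrank_add_le_finrank_add_finrank V V'
  refine ⟨V ⊔ V', inferInstance, by omega, fun x hxV => ?_⟩
  rw [← Submodule.inf_orthogonal] at hxV
  have h1 := hx x hxV.1
  have h2 := hx' x hxV.2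
  have h3 : (C + C') * a (n / 2) * ‖x‖ ^ 2 ≤ (C + C') * (D * a n) * ‖x‖ ^ 2 := by
    gcongr
    exact hD n
  rw [add_apply, inner_add_right, Complex.add_re]
  linarith

omit [CompleteSpace H] in
theorem smul (hA : IsDominatedBy a A) {r : ℝ} (hr : 0 ≤ r) : IsDominatedBy a ((r : ℂ) • A) := by
  obtain ⟨C, hC, h⟩ := hA
  refine ⟨r * C, by positivity, fun n => ?_⟩
  obtain ⟨V, hV, hVn, hx⟩ := h n
  refine ⟨V, hV, hVn, fun x hxV => ?_⟩
  have h1 := mul_le_mul_of_nonneg_left (hx x hxV) hr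
  rw [smul_apply, inner_smul_right, Complex.re_ofReal_mul]
  linarith

/-- On the orthogonal complement of `X V` the vector `X* y` lies in `Vᗮ`. There `‖X* y‖² = ⟨y, X X*
y⟩ ≤ ‖y‖ ‖X (X* y)‖`, and the known bound on the last norm closes the estimate after division by
`‖X* y‖²`. -/
theorem star_mul_self_swap {X : H →L[ℂ] H} (ha : ∀ n, 0 ≤ a n) (h : IsDominatedBy a (star X * X)) :
    IsDominatedBy a (X * star X) := by
  obtain ⟨C, hC, h⟩ := h
  refine ⟨C, hC, fun n => ?_⟩
  obtain ⟨V, hV, hVn, hx⟩ := h n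
  refine ⟨V.map (X : H →ₗ[ℂ] H), inferInstance, (Submodule.finrank_map_le _ _).trans hVn,
    fun y hy => ?_⟩
  have h1 : star X y ∈ Vᗮ := by
    rw [Submodule.mem_orthogonal]
    intro v hv
    rw [ContinuousLinearMap.star_eq_adjoint, ContinuousLinearMap.adjoint_inner_right]
    exact (Submodule.mem_orthogonal _ _).mp hy _ ⟨v, hv, rfl⟩
  have h2 := hx _ h1
  rw [re_inner_star_mul_self] at h2
  have h3 := re_inner_star_mul_self (star X) y
  rw [star_star] at h3
  rw [h3]
  have h4 : ‖star X y‖ ^ 2 ≤ ‖y‖ * ‖X (star X y)‖ := by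
    rw [← h3, mul_apply_eq_comp]
    exact (Complex.re_le_norm _).trans (norm_inner_le_norm _ _)
  set s := ‖star X y‖ with hs
  have h5 : (s ^ 2) ^ 2 ≤ ‖y‖ ^ 2 * (C * a n * s ^ 2) := by
    calc (s ^ 2) ^ 2 ≤ (‖y‖ * ‖X (star X y)‖) ^ 2 := by gcongr
      _ = ‖y‖ ^ 2 * ‖X (star X y)‖ ^ 2 := by ring
      _ ≤ _ := by gcongr
  rcases (sq_nonneg s).eq_or_lt with h6 | h6
  · rw [← h6]
    have := ha n
    positivity
  · refine le_of_mul_le_mul_left ?_ h6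
    linarith

omit [CompleteSpace H] in
theorem of_finiteDimensional_range {P : H →L[ℂ] H}
    (hfin : FiniteDimensional ℂ (LinearMap.range (P : H →ₗ[ℂ] H))) (ha : Antitone a)
    (ha0 : ∀ n, 0 < a n) : IsDominatedBy a P := by
  set k := Module.finrank ℂ (LinearMap.range (P : H →ₗ[ℂ] H)) with hk
  refine ⟨‖P‖ / a k, by have := ha0 k; positivity, fun n => ?_⟩
  rcases le_or_gt k n with hn | hn
  · refine ⟨_, hfin, hn, fun x hx => ?_⟩
    have h1 : inner ℂ x (P x) = (0 : ℂ) := (Submodule.mem_orthogonal' _ _).mp hx _ ⟨x, rfl⟩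
    rw [h1]
    have := ha0 k
    have := ha0 n
    simp only [Complex.zero_re]
    positivity
  · refine ⟨⊥, inferInstance, by simp, fun x _ => (re_inner_le_norm_mul P x).trans ?_⟩
    refine mul_le_mul_of_nonneg_right ?_ (by positivity)
    rw [div_mul_eq_mul_div, le_div_iff₀ (ha0 k)]
    exact mul_le_mul_of_nonneg_left (ha hn.le) (norm_nonneg _)

omit [CompleteSpace H] in
theorem of_diagonal {e : HilbertBasis ℕ ℂ H} (hA : ∀ i, A (e i) = (a i : ℂ) • e i)
    (ha : Antitone a) : IsDominatedBy a A := by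
  refine ⟨1, zero_le_one, fun n => ⟨Submodule.span ℂ (Set.range fun i : Fin n => e i),
    FiniteDimensional.span_of_finite ℂ (Set.finite_range _), (finrank_span_hilbertBasis e n).le,
    fun x hx => ?_⟩⟩
  rw [one_mul]
  exact re_inner_le_of_mem_span_orthogonal hA (fun i hi => ha hi) hx

/-- Subadditivity gives one side. For the other, superadditivity costs a passage from `m` to `2 m`,
which by domination adds at most `2 C m * a m`. -/
theorem abs_kyFanSum_add_sub_le (hA0 : 0 ≤ A) (hB0 : 0 ≤ B) (ha : ∀ n, 0 ≤ a n)
    (h : IsDominatedBy a (A + B)) : ∃ C : ℝ, 0 ≤ C ∧ ∀ m : ℕ,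
      |kyFanSum (A + B) m - kyFanSum A m - kyFanSum B m| ≤ C * (m * a m) := by
  obtain ⟨C, hC, h⟩ := h
  refine ⟨2 * C, by positivity, fun m => ?_⟩
  obtain ⟨V, hV, hVn, hx⟩ := h m
  have h1 := kyFanSum_le_add (add_nonneg hA0 hB0) hVn (mul_nonneg hC (ha m)) hx (2 * m)
  have h2 := add_le_kyFanSum hA0 hB0 m
  have h3 := kyFanSum_add_le A B m
  push_cast at h1
  rw [abs_le]
  constructor
  · linarith
  · have : 0 ≤ 2 * C * (m * a m) := by have := ha m; positivity
    linarith

end IsDominatedBy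

theorem kyFanSum_le_of_finiteDimensional_range {P : H →L[ℂ] H} (hP0 : 0 ≤ P)
    (hfin : FiniteDimensional ℂ (LinearMap.range (P : H →ₗ[ℂ] H))) (n : ℕ) :
    kyFanSum P n ≤ kyFanSum P (Module.finrank ℂ (LinearMap.range (P : H →ₗ[ℂ] H))) := by
  have h := kyFanSum_le_add (V := LinearMap.range (P : H →ₗ[ℂ] H)) hP0 le_rfl le_rfl (fun x hx => by
    have h1 : inner ℂ x (P x) = (0 : ℂ) := (Submodule.mem_orthogonal' _ _).mp hx _ ⟨x, rfl⟩
    rw [h1]; simp) n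
  simpa using h

theorem tendsto_kyFanSum {A : H →L[ℂ] H} (h : BddAbove (Set.range (kyFanSum A))) :
    Tendsto (kyFanSum A) atTop (𝓝 (⨆ m, kyFanSum A m)) :=
  tendsto_atTop_ciSup (kyFanSum_mono_right A) h

theorem bddAbove_kyFanSum_add_iff {A B : H →L[ℂ] H} (hA : 0 ≤ A) (hB : 0 ≤ B) :
    BddAbove (Set.range (kyFanSum (A + B))) ↔
      BddAbove (Set.range (kyFanSum A)) ∧ BddAbove (Set.range (kyFanSum B)) := by
  constructor
  · rintro ⟨C, hC⟩
    constructor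
    · exact ⟨C, by
        rintro _ ⟨m, rfl⟩
        exact (kyFanSum_mono (le_add_of_nonneg_right hB) m).trans (hC ⟨m, rfl⟩)⟩
    · exact ⟨C, by
        rintro _ ⟨m, rfl⟩
        exact (kyFanSum_mono (le_add_of_nonneg_left hA) m).trans (hC ⟨m, rfl⟩)⟩
  · rintro ⟨⟨C, hC⟩, ⟨C', hC'⟩⟩
    exact ⟨C + C', by
      rintro _ ⟨m, rfl⟩
      exact (kyFanSum_add_le A B m).trans (add_le_add (hC ⟨m, rfl⟩) (hC' ⟨m, rfl⟩))⟩

theorem iSup_kyFanSum_add {A B : H →L[ℂ] H} (hA : 0 ≤ A) (hB : 0 ≤ B)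
    (hbA : BddAbove (Set.range (kyFanSum A))) (hbB : BddAbove (Set.range (kyFanSum B))) :
    ⨆ m, kyFanSum (A + B) m = (⨆ m, kyFanSum A m) + ⨆ m, kyFanSum B m := by
  have hab := tendsto_kyFanSum ((bddAbove_kyFanSum_add_iff hA hB).mpr ⟨hbA, hbB⟩)
  have h := (tendsto_kyFanSum hbA).add (tendsto_kyFanSum hbB)
  have h2 : Tendsto (fun m : ℕ => 2 * m) atTop atTop := tendsto_id.const_mul_atTop' two_pos
  exact le_antisymm (le_of_tendsto_of_tendsto' hab h (kyFanSum_add_le A B))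
    (le_of_tendsto_of_tendsto' h (hab.comp h2) (add_le_kyFanSum hA hB))

end Dominated

/-! ### From asymptotically additive functionals to a singular trace. -/

section Construction

variable {H : Type*} [NormedAddCommGroup H] [InnerProductSpace ℂ H] [CompleteSpace H]

/-- The trace is the limit of `v A` along a free ultrafilter, which exists by compactness of `[0,
∞]`, and is `∞` outside `J`. That `J` contains a sum only together with both summands keeps
additivity true when the value is infinite. -/
theorem exists_singularTrace_of_asymptotic {J : (H →L[ℂ] H) → Prop} {v : (H →L[ℂ] H) → ℕ → ℝ}
    (hv0 : ∀ A, J A → ∀ j, 0 ≤ v A j)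
    (hJadd : ∀ A B, 0 ≤ A → 0 ≤ B → (J (A + B) ↔ J A ∧ J B))
    (hvadd : ∀ A B, 0 ≤ A → 0 ≤ B → J A → J B →
      Tendsto (fun j => v (A + B) j - v A j - v B j) atTop (𝓝 0))
    (hJsmul : ∀ (r : ℝ) A, 0 ≤ r → J A → J ((r : ℂ) • A))
    (hvsmul : ∀ (r : ℝ) A, 0 ≤ r → ∀ j, v ((r : ℂ) • A) j = r * v A j)
    (hJstar : ∀ X, J (star X * X) → J (X * star X))
    (hvstar : ∀ X j, v (star X * X) j = v (X * star X) j)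
    (hJproj : ∀ P : H →L[ℂ] H, IsStarProjection P →
      FiniteDimensional ℂ (LinearMap.range (P : H →ₗ[ℂ] H)) → J P)
    (hvproj : ∀ P : H →L[ℂ] H, IsStarProjection P →
      FiniteDimensional ℂ (LinearMap.range (P : H →ₗ[ℂ] H)) → Tendsto (v P) atTop (𝓝 0))
    {T : H →L[ℂ] H} (hT : J T) (hvT : ∀ j, v T j = 1) :
    ∃ τ : SingularTrace H, τ.toFun T = 1 := by
  classical
  let L : (H →L[ℂ] H) → ℝ≥0∞ := fun A =>
    ((hyperfilter ℕ).map fun j => ENNReal.ofReal (v A j)).lim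
  have hL : ∀ A, Tendsto (fun j => ENNReal.ofReal (v A j)) (hyperfilter ℕ) (𝓝 (L A)) :=
    fun A => Ultrafilter.le_nhds_lim _
  have hLeq : ∀ A l, Tendsto (fun j => ENNReal.ofReal (v A j)) (hyperfilter ℕ) (𝓝 l) → L A = l :=
    fun A l h => tendsto_nhds_unique (hL A) h
  have hle : (hyperfilter ℕ : Filter ℕ) ≤ atTop := Nat.hyperfilter_le_atTop
  have hJ0 : J 0 := hJproj 0 (IsStarProjection.zero _) (by
    rw [ContinuousLinearMap.toLinearMap_zero, LinearMap.range_zero]; infer_instance)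
  refine ⟨⟨fun A => if J A then L A else ∞, ?_, ?_, ?_, ?_⟩, ?_⟩
  · intro A B hA hB
    by_cases h : J A ∧ J B
    · rw [if_pos ((hJadd A B hA hB).mpr h), if_pos h.1, if_pos h.2]
      -- Subtraction being truncated in `[0, ∞]`, additivity is proved as two inequalities, each
      -- with the vanishing error `|d|` added on the larger side.
      set d : ℕ → ℝ := fun j => v (A + B) j - v A j - v B j with hd
      have hd0 : Tendsto (fun j => ENNReal.ofReal |d j|) (hyperfilter ℕ) (𝓝 0) := by
        have h1 := ((hvadd A B hA hB h.1 h.2).abs).mono_left hle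
        rw [abs_zero] at h1
        have h2 := (ENNReal.continuous_ofReal.tendsto 0).comp h1
        rwa [ENNReal.ofReal_zero] at h2
      have hs := (hL A).add (hL B)
      have hs' := hs.add hd0
      have hab := (hL (A + B)).add hd0
      rw [add_zero] at hs' hab
      have hJA := hv0 A h.1
      have hJB := hv0 B h.2
      have hJAB := hv0 _ ((hJadd A B hA hB).mpr h)
      refine le_antisymm (le_of_tendsto_of_tendsto' (hL (A + B)) hs' fun j => ?_)
        (le_of_tendsto_of_tendsto' hs hab fun j => ?_)
      · rw [← ENNReal.ofReal_add (hJA j) (hJB j),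
          ← ENNReal.ofReal_add (add_nonneg (hJA j) (hJB j)) (abs_nonneg _)]
        apply ENNReal.ofReal_le_ofReal
        have := le_abs_self (d j)
        simp only [hd] at this ⊢
        linarith
      · rw [← ENNReal.ofReal_add (hJA j) (hJB j),
          ← ENNReal.ofReal_add (hJAB j) (abs_nonneg _)]
        apply ENNReal.ofReal_le_ofReal
        have := neg_abs_le (d j)
        simp only [hd] at this ⊢
        linarith
    · rw [if_neg (fun h' => h ((hJadd A B hA hB).mp h'))]
      rcases not_and_or.mp h with h | h <;> simp [h]
  · intro r A hA
    by_cases h : J A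
    · rw [if_pos (hJsmul r A r.2 h), if_pos h]
      apply hLeq
      have h1 : Tendsto (fun j => (r : ℝ≥0∞) * ENNReal.ofReal (v A j)) (hyperfilter ℕ)
          (𝓝 (r * L A)) := ENNReal.Tendsto.const_mul (hL A) (Or.inr ENNReal.coe_ne_top)
      refine h1.congr fun j => ?_
      rw [hvsmul r A r.coe_nonneg, ENNReal.ofReal_mul r.coe_nonneg, ENNReal.ofReal_coe_nnreal]
    -- Outside `J` the value is `∞`: for `r = 0` the convention `0 * ∞ = 0` matches the value at
    -- `0`, and for `r ≠ 0` the multiple stays outside `J`.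
    · rcases eq_or_ne r 0 with rfl | hr
      · have h1 : L 0 = 0 := by
          apply hLeq
          have h0 : ∀ j, v 0 j = 0 := fun j => by simpa using hvsmul 0 0 le_rfl j
          simp [h0]
        simp [hJ0, h1]
      · have h2 : ¬ J (((r : ℝ) : ℂ) • A) := by
          intro h3
          have h4 := hJsmul (r : ℝ)⁻¹ _ (inv_nonneg.mpr r.2) h3
          rw [smul_smul, ← Complex.ofReal_mul, inv_mul_cancel₀ (by exact_mod_cast hr),
            Complex.ofReal_one, one_smul] at h4
          exact h h4
        rw [if_neg h2, if_neg h, ENNReal.mul_top (by exact_mod_cast hr)]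
  · intro X
    have h1 : J (star X * X) ↔ J (X * star X) :=
      ⟨hJstar X, fun h => by simpa using hJstar (star X) (by simpa using h)⟩
    have h2 : L (star X * X) = L (X * star X) := by
      simp only [L, hvstar]
    simp only [h1, h2]
  · intro P hP hfin
    rw [if_pos (hJproj P hP hfin)]
    apply hLeq
    have h1 := (ENNReal.continuous_ofReal.tendsto 0).comp ((hvproj P hP hfin).mono_left hle)
    rwa [ENNReal.ofReal_zero] at h1
  · simp only [if_pos hT]
    apply hLeq
    simp [hvT]

end Construction

/-! ### Singular traces at the critical exponent. -/

section Existence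

variable {H : Type*} [NormedAddCommGroup H] [InnerProductSpace ℂ H] [CompleteSpace H]
  {e : HilbertBasis ℕ ℂ H} {T : H →L[ℂ] H} {a : ℕ → ℝ}

theorem exists_strictMono_mul_le {a w : ℕ → ℝ}
    (h : ∀ ε > 0, ∃ᶠ m : ℕ in atTop, m * a m ≤ ε * w m) :
    ∃ φ : ℕ → ℕ, StrictMono φ ∧ ∀ j, 1 ≤ φ j ∧ φ j * a (φ j) ≤ 1 / ((j : ℝ) + 1) * w (φ j) :=
  extraction_forall_of_frequently
    (P := fun j m => 1 ≤ m ∧ m * a m ≤ 1 / ((j : ℝ) + 1) * w m) fun j =>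
    ((h (1 / ((j : ℝ) + 1)) (by positivity)).and_eventually (eventually_ge_atTop 1)).mono
      fun _ hm => ⟨hm.2, hm.1⟩

theorem tendsto_zero_of_abs_le_mul {x w b : ℕ → ℝ} {C : ℝ} (hC : 0 ≤ C) (hw : ∀ j, 0 < w j)
    (hx : ∀ j, |x j| ≤ C * b j) (hb : ∀ j : ℕ, b j ≤ 1 / ((j : ℝ) + 1) * w j) :
    Tendsto (fun j => x j / w j) atTop (𝓝 0) := by
  have hlim : Tendsto (fun j : ℕ => C * (1 / ((j : ℝ) + 1))) atTop (𝓝 0) := by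
    simpa using tendsto_one_div_add_atTop_nhds_zero_nat.const_mul C
  refine squeeze_zero_norm (fun j => ?_) hlim
  rw [Real.norm_eq_abs, abs_div, abs_of_pos (hw j), div_le_iff₀ (hw j), mul_assoc]
  exact (hx j).trans (mul_le_mul_of_nonneg_left (hb j) hC)

theorem kyFanSum_pos_of_diagonal (hT : ∀ i, T (e i) = (a i : ℂ) • e i) (ha0 : ∀ i, 0 < a i)
    {m : ℕ} (hm : 1 ≤ m) : 0 < kyFanSum T m := by
  have hon : Orthonormal ℂ (fun _ : Fin 1 => e 0) :=
    e.orthonormal.comp (fun _ : Fin 1 => 0) (Function.injective_of_subsingleton _)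
  have h := le_kyFanSum T hon (m := m) (by simpa using hm)
  refine lt_of_lt_of_le ?_ h
  simp [quadraticSum, hT, e.orthonormal.1, -Complex.coe_smul, ha0]

/-- Ky Fan sums are normalized by those of `T` along the good indices. The normalization tends to
infinity, which makes finite rank projections negligible. -/
theorem exists_singularTrace_of_not_bddAbove (hT : ∀ i, T (e i) = (a i : ℂ) • e i)
    (ha : Antitone a) (ha0 : ∀ i, 0 < a i) {D : ℝ} (hD0 : 0 ≤ D) (hD : ∀ m, a (m / 2) ≤ D * a m)
    (hb : ¬ BddAbove (Set.range (kyFanSum T)))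
    (hfreq : ∀ ε > 0, ∃ᶠ m : ℕ in atTop, m * a m ≤ ε * kyFanSum T m) :
    ∃ τ : SingularTrace H, τ.toFun T = 1 := by
  obtain ⟨φ, hφ, hφa⟩ := exists_strictMono_mul_le hfreq
  have hw : ∀ j, 0 < kyFanSum T (φ j) := fun j => kyFanSum_pos_of_diagonal hT ha0 (hφa j).1
  have hwlim : Tendsto (fun j => kyFanSum T (φ j)) atTop atTop :=
    (tendsto_atTop_atTop_of_monotone (kyFanSum_mono_right T) fun b => by
      by_contra hcon
      push Not at hcon
      exact hb ⟨b, by rintro _ ⟨m, rfl⟩; exact (hcon m).le⟩).comp hφ.tendsto_atTop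
  refine exists_singularTrace_of_asymptotic (J := IsDominatedBy a)
    (v := fun A j => kyFanSum A (φ j) / kyFanSum T (φ j))
    (fun A _ j => div_nonneg (kyFanSum_nonneg _ _) (hw j).le)
    (fun A B hA hB => ⟨fun h => ⟨h.mono (le_add_of_nonneg_right hB),
      h.mono (le_add_of_nonneg_left hA)⟩, fun h => h.1.add h.2 hD0 hD⟩)
    (fun A B hA hB hJA hJB => ?_)
    (fun r A hr h => h.smul hr)
    (fun r A hr j => by rw [kyFanSum_smul hr, mul_div_assoc])
    (fun X h => h.star_mul_self_swap fun n => (ha0 n).le)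
    (fun X j => by rw [kyFanSum_star_mul_self])
    (fun P hP hfin => .of_finiteDimensional_range hfin ha ha0)
    (fun P hP hfin => ?_)
    (IsDominatedBy.of_diagonal hT ha) (fun j => div_self (hw j).ne')
  · obtain ⟨C, hC, h⟩ := IsDominatedBy.abs_kyFanSum_add_sub_le hA hB (fun n => (ha0 n).le)
      (hJA.add hJB hD0 hD)
    simp only [← sub_div]
    exact tendsto_zero_of_abs_le_mul hC hw (fun j => h (φ j)) fun j => (hφa j).2
  · refine squeeze_zero (fun j => div_nonneg (kyFanSum_nonneg _ _) (hw j).le)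
      (fun j => div_le_div_of_nonneg_right
        (kyFanSum_le_of_finiteDimensional_range hP.nonneg hfin (φ j)) (hw j).le) ?_
    exact tendsto_const_nhds.div_atTop hwlim

/-- When the Ky Fan sums of `T` are bounded, tails take the place of sums. Their total masses add
exactly, so the additivity error is again that of the Ky Fan sums, and finite rank projections have
zero tails eventually. -/
theorem exists_singularTrace_of_bddAbove (hT : ∀ i, T (e i) = (a i : ℂ) • e i)
    (ha : Antitone a) (ha0 : ∀ i, 0 < a i) {D : ℝ} (hD0 : 0 ≤ D) (hD : ∀ m, a (m / 2) ≤ D * a m)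
    (hb : BddAbove (Set.range (kyFanSum T)))
    (hpos : ∀ m, 1 ≤ m → 0 < (⨆ n, kyFanSum T n) - kyFanSum T m)
    (hfreq : ∀ ε > 0, ∃ᶠ m : ℕ in atTop, m * a m ≤ ε * ((⨆ n, kyFanSum T n) - kyFanSum T m)) :
    ∃ τ : SingularTrace H, τ.toFun T = 1 := by
  obtain ⟨φ, hφ, hφa⟩ := exists_strictMono_mul_le hfreq
  have hw : ∀ j, 0 < (⨆ n, kyFanSum T n) - kyFanSum T (φ j) := fun j => hpos _ (hφa j).1
  have hproj : ∀ P : H →L[ℂ] H, IsStarProjection P →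
      FiniteDimensional ℂ (LinearMap.range (P : H →ₗ[ℂ] H)) →
      BddAbove (Set.range (kyFanSum P)) := fun P hP hfin => ⟨_, by
    rintro _ ⟨m, rfl⟩; exact kyFanSum_le_of_finiteDimensional_range hP.nonneg hfin m⟩
  refine exists_singularTrace_of_asymptotic
    (J := fun A => IsDominatedBy a A ∧ BddAbove (Set.range (kyFanSum A)))
    (v := fun A j => ((⨆ n, kyFanSum A n) - kyFanSum A (φ j)) /
      ((⨆ n, kyFanSum T n) - kyFanSum T (φ j)))
    (fun A hA j => div_nonneg (sub_nonneg.mpr (le_ciSup hA.2 _)) (hw j).le)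
    (fun A B hA hB => ?_)
    (fun A B hA hB hJA hJB => ?_)
    (fun r A hr h => ⟨h.1.smul hr, ?_⟩)
    (fun r A hr j => ?_)
    (fun X h => ⟨h.1.star_mul_self_swap fun n => (ha0 n).le, ?_⟩)
    (fun X j => by simp only [kyFanSum_star_mul_self])
    (fun P hP hfin => ⟨.of_finiteDimensional_range hfin ha ha0, hproj P hP hfin⟩)
    (fun P hP hfin => ?_)
    ⟨IsDominatedBy.of_diagonal hT ha, hb⟩ (fun j => div_self (hw j).ne')
  · rw [bddAbove_kyFanSum_add_iff hA hB]
    exact ⟨fun h => ⟨⟨h.1.mono (le_add_of_nonneg_right hB), h.2.1⟩,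
      ⟨h.1.mono (le_add_of_nonneg_left hA), h.2.2⟩⟩,
      fun h => ⟨h.1.1.add h.2.1 hD0 hD, h.1.2, h.2.2⟩⟩
  · obtain ⟨C, hC, h⟩ := IsDominatedBy.abs_kyFanSum_add_sub_le hA hB (fun n => (ha0 n).le)
      (hJA.1.add hJB.1 hD0 hD)
    simp only [← sub_div]
    refine tendsto_zero_of_abs_le_mul hC hw (fun j => ?_) fun j => (hφa j).2
    refine le_trans (le_of_eq ?_) (h (φ j))
    rw [iSup_kyFanSum_add hA hB hJA.2 hJB.2, ← abs_neg]
    congr 1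
    ring
  · obtain ⟨C, hC⟩ := h.2
    exact ⟨r * C, by
      rintro _ ⟨m, rfl⟩
      rw [kyFanSum_smul hr]
      exact mul_le_mul_of_nonneg_left (hC ⟨m, rfl⟩) hr⟩
  · simp only [kyFanSum_smul hr]
    rw [← Real.mul_iSup_of_nonneg hr, ← mul_sub, mul_div_assoc]
  · have : kyFanSum (X * star X) = kyFanSum (star X * X) :=
      funext fun m => (kyFanSum_star_mul_self X m).symm
    rw [this]
    exact h.2
  · set k := Module.finrank ℂ (LinearMap.range (P : H →ₗ[ℂ] H))
    have hle := kyFanSum_le_of_finiteDimensional_range hP.nonneg hfin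
    refine tendsto_const_nhds.congr' ?_
    filter_upwards [hφ.tendsto_atTop.eventually (eventually_ge_atTop k)] with j hj
    have h1 : ⨆ n, kyFanSum P n = kyFanSum P (φ j) :=
      le_antisymm (ciSup_le fun n => (hle n).trans (kyFanSum_mono_right P hj))
        (le_ciSup (hproj P hP hfin) _)
    rw [h1, sub_self, zero_div]

theorem exists_singularTrace_of_regularDecay (hT : ∀ i, T (e i) = (a i : ℂ) • e i)
    (ha : Antitone a) (ha0 : ∀ i, 0 < a i) (h : RegularDecay (fun n => a (n - 1)) 1) :
    ∃ τ : SingularTrace H, τ.toFun T = 1 := by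
  have hl : Antitone fun n => a (n - 1) := fun m n hmn => ha (Nat.sub_le_sub_right hmn 1)
  have hl0 : ∀ n, 0 < a (n - 1) := fun n => ha0 _
  obtain ⟨D, hD0, hD⟩ := h.exists_doubling hl hl0
  simp only [Nat.add_sub_cancel] at hD
  have hincr : ∀ n : ℕ, kyFanSum T n + n * a (2 * n - 1) ≤ kyFanSum T (2 * n) := fun n =>
    kyFanSum_add_le_of_diagonal hT fun i hi => ha (by omega)
  -- Domination bounds the form by `a m` in codimension `m`, while decay is stated for the sequence
  -- shifted to start at `1`; monotonicity reconciles the two.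
  have hale : ∀ m : ℕ, (m : ℝ) * a m ≤ m * a (m - 1) := fun m =>
    mul_le_mul_of_nonneg_left (ha (Nat.sub_le m 1)) (Nat.cast_nonneg m)
  by_cases hb : BddAbove (Set.range (kyFanSum T))
  · have hdecr : ∀ n : ℕ, (⨆ k, kyFanSum T k) - kyFanSum T (2 * n) + n * a (2 * n - 1) ≤
        (⨆ k, kyFanSum T k) - kyFanSum T n := fun n => by linarith [hincr n]
    have hnonneg : ∀ n, 0 ≤ (⨆ k, kyFanSum T k) - kyFanSum T n := fun n =>
      sub_nonneg.mpr (le_ciSup hb n)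
    refine exists_singularTrace_of_bddAbove hT ha ha0 hD0.le hD hb (fun m hm => ?_) fun ε hε =>
      (h.frequently_le_of_decrements hl hl0 hnonneg hdecr hε).mono fun m hm => (hale m).trans hm
    have h1 : 0 < (m : ℝ) * a (2 * m - 1) := mul_pos (by exact_mod_cast hm) (ha0 _)
    linarith [hdecr m, hnonneg (2 * m)]
  · exact exists_singularTrace_of_not_bddAbove hT ha ha0 hD0.le hD hb fun ε hε =>
      (h.frequently_le_of_increments hl0 (fun n hn => kyFanSum_pos_of_diagonal hT ha0 hn)
        hincr hε).mono fun m hm => (hale m).trans hm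

end Existence

/-! ### Dimension and exponents of a spectral triple. -/

namespace SpectralTriple

variable {𝓐 H : Type*} [NonUnitalRing 𝓐] [Module ℂ 𝓐]
    [IsScalarTower ℂ 𝓐 𝓐] [SMulCommClass ℂ 𝓐 𝓐]
  [NormedAddCommGroup H] [InnerProductSpace ℂ H] [CompleteSpace H]

/-- In finite dimension the singular values eventually vanish, and the convention `log 0 = 0` makes
all slopes eventually `0`. The limit would be `0`, the inverse of `∞` and not of a real `c`. -/
theorem infinite_dimensional_of_isLowerC (S : SpectralTriple 𝓐 H) {c : ℝ}
    (h : IsLowerC S.absDinv (ENNReal.ofReal c)) : ¬ FiniteDimensional ℂ H := by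
  intro hfin
  have hfl : Tendsto (fun t : ℝ => ⌊Real.exp t⌋₊) atTop atTop :=
    tendsto_nat_floor_atTop.comp Real.tendsto_exp_atTop
  have h0 : ∀ᶠ t : ℝ in atTop, logSingularValue S.absDinv t = 0 := by
    filter_upwards [hfl.eventually (eventually_gt_atTop (Module.finrank ℂ H))] with t ht
    rw [logSingularValue, singularValue_eq_zero_of_finrank_lt _ ht, Real.log_zero, neg_zero]
  have h1 : ∀ x : ℝ, limsup (fun t : ℝ => ENNReal.ofReal
      ((logSingularValue S.absDinv (t + x) - logSingularValue S.absDinv t) / x)) atTop = 0 := by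
    intro x
    rw [limsup_congr (v := fun _ => 0), limsup_const]
    filter_upwards [h0, (tendsto_atTop_add_const_right atTop x tendsto_id).eventually h0]
      with t ht ht'
    simp only [id] at ht'
    simp [ht, ht']
  rw [IsLowerC] at h
  simp only [h1] at h
  have h2 := tendsto_nhds_unique h tendsto_const_nhds
  exact ENNReal.ofReal_ne_top (ENNReal.inv_eq_zero.mp h2)

/-- In finite dimension the quotients are eventually `0 / 0 = 0`, which excludes a limit above `1`.
-/
theorem infinite_dimensional_of_tendsto_ratio (S : SpectralTriple 𝓐 H) {L : ℝ} (hL : 1 < L)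
    (h : Tendsto (fun n : ℕ => singularValue S.Dinv n / singularValue S.Dinv (2 * n)) atTop
      (𝓝 L)) : ¬ FiniteDimensional ℂ H := by
  intro hfin
  have h0 : Tendsto (fun n : ℕ => singularValue S.Dinv n / singularValue S.Dinv (2 * n)) atTop
      (𝓝 0) := by
    refine tendsto_const_nhds.congr' ?_
    filter_upwards [eventually_gt_atTop (Module.finrank ℂ H)] with n hn
    rw [singularValue_eq_zero_of_finrank_lt _ hn, zero_div]
  linarith [tendsto_nhds_unique h h0]

section Diagonalized

variable (S : SpectralTriple 𝓐 H) {e : HilbertBasis ℕ ℂ H} {a : ℕ → ℝ}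

theorem rpow_absDinv_apply (hD : ∀ i, S.absDinv (e i) = (a i : ℂ) • e i) {d : ℝ} (hd : 0 < d)
    (i : ℕ) : (S.absDinv ^ d) (e i) = ((a i ^ d : ℝ) : ℂ) • e i :=
  rpow_apply_eigenvector S.absDinv_nonneg hd (hD i)

theorem sum_singularValue_rpow_absDinv (hD : ∀ i, S.absDinv (e i) = (a i : ℂ) • e i)
    (ha : Antitone a) (ha0 : ∀ i, 0 < a i) {d : ℝ} (hd : 0 < d) (n : ℕ) :
    ∑ k ∈ Finset.Icc 1 n, singularValue (S.absDinv ^ d) k = ∑ k ∈ Finset.range n, a k ^ d := by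
  have hanti : Antitone fun k => a k ^ d := fun m n hmn =>
    Real.rpow_le_rpow (ha0 n).le (ha hmn) hd.le
  induction n with
  | zero => simp
  | succ n ih =>
    rw [Finset.sum_Icc_succ_top (by omega), ih, Finset.sum_range_succ,
      singularValue_of_diagonal (S.rpow_absDinv_apply hD hd) hanti
        fun i => (Real.rpow_pos_of_pos (ha0 i) d).le]

theorem isCompactOperator_rpow_absDinv (hD : ∀ i, S.absDinv (e i) = (a i : ℂ) • e i)
    (ha : Antitone a) (ha0 : ∀ i, 0 < a i) (hlim : Tendsto a atTop (𝓝 0)) {d : ℝ} (hd : 0 < d) :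
    IsCompactOperator (S.absDinv ^ d) := by
  refine isCompactOperator_of_diagonal (S.rpow_absDinv_apply hD hd)
    (fun i => (Real.rpow_pos_of_pos (ha0 i) d).le)
    (fun m n hmn => Real.rpow_le_rpow (ha0 n).le (ha hmn) hd.le) ?_
  have h := hlim.rpow_const (p := d) (Or.inr hd.le)
  rwa [Real.zero_rpow hd.ne'] at h

theorem memL1InftyZero_of_lt (hD : ∀ i, S.absDinv (e i) = (a i : ℂ) • e i)
    (ha : Antitone a) (ha0 : ∀ i, 0 < a i) (hlim : Tendsto a atTop (𝓝 0)) {d : ℝ} (hd : 0 < d)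
    {s : ℝ} (h : RegularDecay (fun n => a (n - 1) ^ d) s) (hs : 1 < s) :
    MemL1InftyZero (S.absDinv ^ d) := by
  refine ⟨S.isCompactOperator_rpow_absDinv hD ha ha0 hlim hd, ?_⟩
  simp only [S.sum_singularValue_rpow_absDinv hD ha ha0 hd]
  obtain ⟨M, hM, r, hr, hrM, hk⟩ := h.exists_contraction (fun m n hmn =>
    Real.rpow_le_rpow (ha0 _).le (ha (Nat.sub_le_sub_right hmn 1)) hd.le) hs
  simp only [Nat.add_sub_cancel] at hk
  have hpos : ∀ n, 0 ≤ a n ^ d := fun n => (Real.rpow_pos_of_pos (ha0 n) d).le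
  obtain ⟨C, hC⟩ := exists_sum_range_le_of_contraction hpos hM hr hrM hk
  have h1 : (fun n : ℕ => ∑ k ∈ Finset.range n, a k ^ d) =O[atTop] (fun _ : ℕ => (1 : ℝ)) := by
    refine Asymptotics.IsBigO.of_bound C (Eventually.of_forall fun n => ?_)
    rw [Real.norm_of_nonneg (Finset.sum_nonneg fun i _ => hpos i)]
    simpa using hC n
  exact h1.trans_isLittleO ((Real.isLittleO_const_log_atTop (c := (1 : ℝ))).comp_tendsto
    tendsto_natCast_atTop_atTop)

theorem not_memL1Infty_of_lt (hD : ∀ i, S.absDinv (e i) = (a i : ℂ) • e i)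
    (ha : Antitone a) (ha0 : ∀ i, 0 < a i) {d : ℝ} (hd : 0 < d)
    {s : ℝ} (h : RegularDecay (fun n => a (n - 1) ^ d) s) (hs : s < 1) :
    ¬ MemL1Infty (S.absDinv ^ d) := by
  rintro ⟨-, hO⟩
  simp only [S.sum_singularValue_rpow_absDinv hD ha ha0 hd] at hO
  obtain ⟨M, hM, r, hr, hrM, hk⟩ := h.exists_expansion (fun m n hmn =>
    Real.rpow_le_rpow (ha0 _).le (ha (Nat.sub_le_sub_right hmn 1)) hd.le) hs
  simp only [Nat.add_sub_cancel] at hk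
  exact not_isBigO_log_of_expansion (fun n => Real.rpow_pos_of_pos (ha0 n) d)
    (fun m n hmn => Real.rpow_le_rpow (ha0 n).le (ha hmn) hd.le) hM hr hrM hk hO

theorem eq_of_isExponentOfSingularTraceability (hD : ∀ i, S.absDinv (e i) = (a i : ℂ) • e i)
    (ha : Antitone a) (ha0 : ∀ i, 0 < a i) {α : ℝ}
    {s : ℝ} (h : RegularDecay (fun n => a (n - 1) ^ α) s)
    (hα : IsExponentOfSingularTraceability S.Dinv α) : s = 1 := by
  obtain ⟨hα0, τ, hτ⟩ := hα
  have hanti : Antitone fun n => a (n - 1) ^ α := fun m n hmn =>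
    Real.rpow_le_rpow (ha0 _).le (ha (Nat.sub_le_sub_right hmn 1)) hα0.le
  have hdiag := S.rpow_absDinv_apply hD hα0
  have hpos : ∀ n, 0 ≤ a n ^ α := fun n => (Real.rpow_pos_of_pos (ha0 n) α).le
  rcases lt_trichotomy s 1 with hs | hs | hs
  · obtain ⟨M, hM, r, hr, hrM, hk⟩ := h.exists_expansion hanti hs
    exact absurd hτ (τ.toFun_ne_one_of_expansion hdiag hpos (by omega) hr.le hrM hk)
  · exact hs
  · obtain ⟨M, hM, r, hr, hrM, hk⟩ := h.exists_contraction hanti hs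
    exact absurd hτ (τ.toFun_ne_one_of_contraction hdiag hpos (by omega) hr.le hrM hk)

theorem isExponentOfSingularTraceability_of_regularDecay
    (hD : ∀ i, S.absDinv (e i) = (a i : ℂ) • e i) (ha : Antitone a) (ha0 : ∀ i, 0 < a i)
    {α : ℝ} (hα : 0 < α) (h : RegularDecay (fun n => a (n - 1) ^ α) 1) :
    IsExponentOfSingularTraceability S.Dinv α :=
  ⟨hα, exists_singularTrace_of_regularDecay (S.rpow_absDinv_apply hD hα)
    (fun _ n hmn => Real.rpow_le_rpow (ha0 n).le (ha hmn) hα.le)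
    (fun i => Real.rpow_pos_of_pos (ha0 i) α) h⟩

end Diagonalized

theorem dimension_eq (S : SpectralTriple 𝓐 H) {c : ℝ} (hc : 0 < c)
    (h1 : ∀ d, c < d → MemL1InftyZero (S.absDinv ^ d))
    (h2 : ∀ d, 0 < d → d < c → ¬ MemL1Infty (S.absDinv ^ d)) :
    S.dimension = ENNReal.ofReal c ∧ S.dimensionSup = ENNReal.ofReal c := by
  have h0 : ∀ T : H →L[ℂ] H, MemL1InftyZero T → MemL1Infty T := fun T h => ⟨h.1, h.2.isBigO⟩
  constructor
  · refine le_antisymm (le_of_forall_gt fun x hx => ?_) (le_sInf ?_)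
    · obtain ⟨y, hy1, hy2⟩ := exists_between hx
      have hy3 : y ≠ ∞ := hy2.ne_top
      refine lt_of_le_of_lt (sInf_le ⟨y.toReal, ?_, ENNReal.ofReal_toReal hy3⟩) hy2
      have hcy : c < y.toReal := (ENNReal.ofReal_lt_iff_lt_toReal hc.le hy3).mp hy1
      exact ⟨hc.trans hcy, h1 _ hcy⟩
    · rintro _ ⟨d, ⟨hd, hd'⟩, rfl⟩
      apply ENNReal.ofReal_le_ofReal
      by_contra hcon
      exact h2 d hd (not_le.mp hcon) (h0 _ hd')
  · refine le_antisymm (sSup_le ?_) (le_of_forall_lt fun x hx => ?_)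
    · rintro _ ⟨d, ⟨hd, hd'⟩, rfl⟩
      apply ENNReal.ofReal_le_ofReal
      by_contra hcon
      exact hd' (h0 _ (h1 d (not_le.mp hcon)))
    · obtain ⟨y, hy1, hy2⟩ := exists_between hx
      have hy3 : y ≠ ∞ := hy2.ne_top
      refine lt_of_lt_of_le hy1 (le_sSup ⟨y.toReal, ?_, ENNReal.ofReal_toReal hy3⟩)
      have hy0 : 0 < y.toReal := ENNReal.toReal_pos (pos_of_gt hy1).ne' hy3
      exact ⟨hy0, h2 _ hy0 (ENNReal.lt_ofReal_iff_toReal_lt hy3 |>.mp hy2)⟩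

end SpectralTriple

theorem proposition3p6 {𝓐 H : Type*} [NonUnitalRing 𝓐] [Module ℂ 𝓐]
    [IsScalarTower ℂ 𝓐 𝓐] [SMulCommClass ℂ 𝓐 𝓐]
    [NormedAddCommGroup H] [InnerProductSpace ℂ H] [CompleteSpace H]
    (S : SpectralTriple 𝓐 H) :
    (∀ c : ℝ, 0 < c →
      IsLowerC S.absDinv (ENNReal.ofReal c) → IsUpperC S.absDinv (ENNReal.ofReal c) →
        S.dimension = ENNReal.ofReal c ∧ S.dimensionSup = ENNReal.ofReal c ∧
        IsExponentOfSingularTraceability S.Dinv c ∧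
        ∀ α : ℝ, IsExponentOfSingularTraceability S.Dinv α → α = c) ∧
    (∀ L : ℝ, 1 < L →
      Tendsto (fun n : ℕ => singularValue S.Dinv n / singularValue S.Dinv (2 * n)) atTop (𝓝 L) →
        ∃ c : ℝ, 0 < c ∧
          IsLowerC S.absDinv (ENNReal.ofReal c) ∧ IsUpperC S.absDinv (ENNReal.ofReal c)) := by
  have hsv : ∀ {e : HilbertBasis ℕ ℂ H} {a : ℕ → ℝ},
      (∀ i, S.absDinv (e i) = (a i : ℂ) • e i) → Antitone a → (∀ i, 0 < a i) →
      ∀ n, 1 ≤ n → singularValue S.absDinv n = a (n - 1) := by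
    intro e a hD ha ha0 n hn
    obtain ⟨k, rfl⟩ := Nat.exists_eq_add_of_le' hn
    exact singularValue_of_diagonal hD ha (fun i => (ha0 i).le) k
  refine ⟨fun c hc hl hu => ?_, fun L hL h => ?_⟩
  · obtain ⟨e, a, hD, ha0, ha, hlim⟩ :=
      S.exists_diagonalization (S.infinite_dimensional_of_isLowerC hl)
    have hdecay := regularDecay_of_isLowerC_of_isUpperC (hsv hD ha ha0) (fun n => ha0 _) hc hl hu
    have hpow : ∀ d, 0 < d → RegularDecay (fun n => a (n - 1) ^ d) (c⁻¹ * d) := fun d hd =>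
      hdecay.rpow (fun n => ha0 _) hd
    obtain ⟨h1, h2⟩ := S.dimension_eq hc
      (fun d hd => S.memL1InftyZero_of_lt hD ha ha0 hlim (hc.trans hd) (hpow d (hc.trans hd))
        (by rw [inv_mul_eq_div, one_lt_div hc]; exact hd))
      (fun d hd hdc => S.not_memL1Infty_of_lt hD ha ha0 hd (hpow d hd)
        (by rw [inv_mul_eq_div, div_lt_one hc]; exact hdc))
    refine ⟨h1, h2, S.isExponentOfSingularTraceability_of_regularDecay hD ha ha0 hc ?_,
      fun α hα => ?_⟩
    · have := hpow c hc
      rwa [inv_mul_cancel₀ hc.ne'] at this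
    · have := S.eq_of_isExponentOfSingularTraceability hD ha ha0 (hpow α hα.1) hα
      rw [inv_mul_eq_div, div_eq_one_iff_eq hc.ne'] at this
      exact this
  · obtain ⟨e, a, hD, ha0, ha, hlim⟩ :=
      S.exists_diagonalization (S.infinite_dimensional_of_tendsto_ratio hL h)
    rw [← S.singularValue_absDinv] at h
    -- A doubling of the index divides the sequence by about `L`, as for `n ^ (-log L / log 2)`; `c`
    -- is the inverse of that exponent.
    refine ⟨Real.log 2 / Real.log L, div_pos (Real.log_pos one_lt_two) (Real.log_pos hL),
      isLowerC_and_isUpperC_of_tendsto_ratio (hsv hD ha ha0)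
        (fun m n hmn => ha (Nat.sub_le_sub_right hmn 1)) (fun n => ha0 _) hL (h.congr' ?_)⟩
    filter_upwards [eventually_ge_atTop 1] with n hn
    rw [hsv hD ha ha0 n hn, hsv hD ha ha0 (2 * n) (by omega)]
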